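/- Let $\mathrm{Ai}$ be the Airy function, $\mathrm{Ai}(x)=\frac1{2\pi}\int_{\mathrm{Im}\,\zeta=1}e^{i(\zeta^3/3+x\zeta)}\,d\zeta=\frac1\pi\int_0^\infty\cos\left(\frac{t^3}{3}+xt\right)dt$ (the second integral being improper), and let $$K(x,y)=\frac{\mathrm{Ai}(x)\,\mathrm{Ai}'(y)-\mathrm{Ai}'(x)\,\mathrm{Ai}(y)}{x-y}\quad(x\ne y),\qquad K(x,x)=\mathrm{Ai}'(x)^2-x\,\mathrm{Ai}(x)^2,$$ be the Airy kernel. For real $s$ let $K_s$ be the integral operator $(K_sf)(x)=\int_s^\infty K(x,y)f(y)\,dy$ on $L^2(s,\infty)$. Then the eigenvalues of $K_s$, counted with multiplicity, can be listed in decreasing order, $\lambda_0(s)\ge\lambda_1(s)\ge\cdots$, in the sense that for each $i=0,1,2,\ldots$ there is a largest real number $\lambda_i(s)$ such that at least $i+1$ eigenvalues of $K_s$ (counted with multiplicity) are $\ge\lambda_i(s)$; and for each fixed $i$, $$\lambda_i(s)\to1\quad\text{as } s\to-\infty.$$ -/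

import Mathlib

open MeasureTheory Set Filter Topology

/-- The Airy function `Ai` on the real line, by its absolutely convergent contour integral
`Ai(x) = (1 / 2π) ∫_{Im ζ = 1} exp (i (ζ³ / 3 + x ζ)) dζ`, where `ζ = t + i`, `t ∈ ℝ`.
(The integral is real: `t ↦ -t` conjugates the integrand. Shifting the contour to the real line
gives the improper integral `(1 / π) ∫_0^∞ cos (t³ / 3 + x t) dt`.) -/
noncomputable def airyAi (x : ℝ) : ℝ :=
  (1 / (2 * Real.pi)) *
    (∫ t : ℝ, Complex.exp (Complex.I *
      (((t : ℂ) + Complex.I) ^ 3 / 3 + (x : ℂ) * ((t : ℂ) + Complex.I)))).re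

/-- The Airy kernel `(Ai(x) Ai'(y) - Ai'(x) Ai(y)) / (x - y)`, extended to the diagonal by its
limit `Ai'(x)² - x Ai(x)²`. -/
noncomputable def airyKernel (x y : ℝ) : ℝ :=
  if x = y then deriv airyAi x ^ 2 - x * airyAi x ^ 2
  else (airyAi x * deriv airyAi y - deriv airyAi x * airyAi y) / (x - y)

/-- `f ∈ L²(s, ∞)` is an eigenfunction, with eigenvalue `ν`, of the integral operator
`(K f)(x) = ∫_s^∞ K(x, y) f(y) dy` with the Airy kernel. -/
def IsAiryEigenfunction (s ν : ℝ) (f : Lp ℝ 2 (volume.restrict (Ioi s))) : Prop :=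
  f ≠ 0 ∧ ∀ᵐ x ∂volume.restrict (Ioi s),
    IntegrableOn (fun y => airyKernel x y * f y) (Ioi s) ∧
      ∫ y in Ioi s, airyKernel x y * f y = ν * f x

/-- The real numbers `r` such that at least `n` eigenvalues, counted with multiplicity, of the Airy
operator on `L²(s, ∞)` are `≥ r`: there are `n` linearly independent eigenfunctions whose
eigenvalues are all `≥ r`. -/
def airyEigenvalueLowerBounds (s : ℝ) (n : ℕ) : Set ℝ :=
  {r | ∃ f : Fin n → Lp ℝ 2 (volume.restrict (Ioi s)), LinearIndependent ℝ f ∧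
    ∀ k, ∃ ν, r ≤ ν ∧ IsAiryEigenfunction s ν (f k)}

/-- `λ_i(s)`: the eigenvalue number `i` of the Airy operator on `L²(s, ∞)`, where the eigenvalues
are listed in decreasing order `λ_0 ≥ λ_1 ≥ ⋯` with multiplicity. It is the largest `r` such that
at least `i + 1` eigenvalues are `≥ r`. -/
noncomputable def airyEigenvalue (i : ℕ) (s : ℝ) : ℝ :=
  sSup (airyEigenvalueLowerBounds s (i + 1))

/-! The Airy equation makes Ai(x+z) Ai(y+z) an explicit z-derivative, so K(x,y) = ∫_0^∞ Ai(x+z)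
Ai(y+z) dz (`airyKernel_eq_integral`). Hence K_s = A A*, where A : L²(0,∞) → L²(s,∞) has kernel
Ai(x+z). On the whole line the Airy transform is a unimodular multiplier placed between two Fourier
transforms, so it preserves the L² norm (`integral_sq_airyTransform`). Cut down to half lines it
becomes a contraction, which bounds the eigenvalues by 1. For a fixed test function f on (0,∞), ‖A
f‖ → ‖f‖ as s → -∞, because (s,∞) exhausts the line.

For the lower bound, let E be spanned by i+1 orthonormal test functions on (0,∞), and let 0 < r < 1.
For s sufficiently negative, ‖A f‖² ≥ r‖f‖² on E. Cauchy–Schwarz turns this into ⟪K_s v, v⟫ ≥ r‖v‖²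
on A(E), which still has dimension i+1, and the min-max principle
(`exists_linearIndependent_eigenvectors`) yields i+1 eigenvalues ≥ r.

The exponential decay of Ai makes A Hilbert–Schmidt, so K_s is compact. Only finitely many
eigenvalues then exceed a given positive level, and the supremum defining λ_i(s) is attained
(`isGreatest_sSup_eigenvalueLowerBounds`). -/

open scoped FourierTransform SchwartzMap ContDiff InnerProductSpace

/-! ### Contour integrals: derivatives, decay and differential equation of Ai -/

/-- The integrand `exp (i (ζ³ / 3 + x ζ))` of the contour integral for the Airy function. -/
noncomputable def airyPhase (x : ℝ) (ζ : ℂ) : ℂ :=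
  Complex.exp (Complex.I * (ζ ^ 3 / 3 + (x : ℂ) * ζ))

/-- The point `t + iη`. -/
noncomputable def horizontal (η t : ℝ) : ℂ := (t : ℂ) + (η : ℂ) * Complex.I

@[fun_prop]
lemma continuous_airyPhase (x : ℝ) : Continuous (airyPhase x) := by
  unfold airyPhase; fun_prop

@[fun_prop]
lemma continuous_horizontal (η : ℝ) : Continuous (horizontal η) := by
  unfold horizontal; fun_prop

/-- The imaginary part of (t + iη)³/3 is ηt² - η³/3: Gaussian decay for η > 0, and modulus one at η
= 0. -/
lemma norm_airyPhase (x η t : ℝ) :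
    ‖airyPhase x (horizontal η t)‖ = Real.exp (-η * t ^ 2 + (η ^ 3 / 3 - x * η)) := by
  rw [airyPhase, Complex.norm_exp]
  congr 1
  have : Complex.I * (horizontal η t ^ 3 / 3 + (x : ℂ) * horizontal η t) =
      ((-η * t ^ 2 + (η ^ 3 / 3 - x * η) : ℝ) : ℂ) +
        ((t ^ 3 / 3 - t * η ^ 2 + x * t : ℝ) : ℂ) * Complex.I := by
    simp only [horizontal]
    push_cast
    linear_combination (t ^ 2 * η + η ^ 3 / 3 * (Complex.I ^ 2 - 1) + x * η + t * η ^ 2 * Complex.I) * Complex.I_sq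
  rw [this, Complex.add_re, Complex.ofReal_re, Complex.re_ofReal_mul, Complex.I_re, mul_zero, add_zero]

lemma norm_horizontal_sq (η t : ℝ) : ‖horizontal η t‖ ^ 2 = t ^ 2 + η ^ 2 := by
  rw [← Complex.normSq_eq_norm_sq, horizontal, Complex.normSq_add_mul_I]

lemma norm_horizontal_one_le (t : ℝ) : ‖horizontal 1 t‖ ≤ 1 + t ^ 2 := by
  have := norm_horizontal_sq 1 t
  nlinarith [norm_nonneg (horizontal 1 t), sq_nonneg t]

lemma integrable_pow_mul_exp_neg_mul_sq {b : ℝ} (hb : 0 < b) (n : ℕ) :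
    Integrable fun t : ℝ => t ^ n * Real.exp (-b * t ^ 2) := by
  simpa using integrable_rpow_mul_exp_neg_mul_sq hb
    (s := n) (by have : (0 : ℝ) ≤ n := n.cast_nonneg
                 linarith)

lemma integrable_const_add_sq_pow_mul_exp {b : ℝ} (hb : 0 < b) (c : ℝ) (n : ℕ) :
    Integrable fun t : ℝ => (c + t ^ 2) ^ n * Real.exp (-b * t ^ 2) := by
  simp only [add_pow, Finset.sum_mul, ← pow_mul]
  refine integrable_finsetSum _ fun i _ => ?_
  refine ((integrable_pow_mul_exp_neg_mul_sq hb (2 * (n - i))).const_mul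
    (c ^ i * n.choose i)).congr (ae_of_all _ fun t => ?_)
  ring

/-- The integrals `∫ (iζ)^k exp (i (ζ³ / 3 + x ζ)) dζ` over `Im ζ = 1`. -/
noncomputable def airyMoment (k : ℕ) (x : ℝ) : ℂ :=
  ∫ t : ℝ, (Complex.I * horizontal 1 t) ^ k * airyPhase x (horizontal 1 t)

lemma norm_airyMoment_integrand_le (k : ℕ) (x t : ℝ) :
    ‖(Complex.I * horizontal 1 t) ^ k * airyPhase x (horizontal 1 t)‖ ≤
      Real.exp (1 - x) * ((1 + t ^ 2) ^ k * Real.exp (-1 * t ^ 2)) := by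
  rw [norm_mul, norm_pow, norm_mul, Complex.norm_I, one_mul, norm_airyPhase, Real.exp_add]
  calc _ ≤ (1 + t ^ 2) ^ k * (Real.exp (-1 * t ^ 2) * Real.exp (1 - x)) := by
        gcongr
        · exact norm_horizontal_one_le t
        · norm_num
        · simp
    _ = _ := by ring

lemma integrable_airyMoment_integrand (k : ℕ) (x : ℝ) :
    Integrable fun t : ℝ => (Complex.I * horizontal 1 t) ^ k * airyPhase x (horizontal 1 t) :=
  ((integrable_const_add_sq_pow_mul_exp one_pos 1 k).const_mul _).mono'
    (by fun_prop) (ae_of_all _ (norm_airyMoment_integrand_le k x))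

lemma exists_norm_airyMoment_le (k : ℕ) :
    ∃ C, 0 ≤ C ∧ ∀ x, ‖airyMoment k x‖ ≤ C * Real.exp (-x) := by
  refine ⟨Real.exp 1 * ∫ t : ℝ, (1 + t ^ 2) ^ k * Real.exp (-1 * t ^ 2),
    mul_nonneg (Real.exp_nonneg _) (integral_nonneg fun t => by positivity), fun x => ?_⟩
  refine (norm_integral_le_of_norm_le
    ((integrable_const_add_sq_pow_mul_exp one_pos 1 k).const_mul _)
    (ae_of_all _ (norm_airyMoment_integrand_le k x))).trans_eq ?_
  rw [integral_const_mul, sub_eq_add_neg, Real.exp_add]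
  ring

lemma hasDerivAt_airyPhase_left (x : ℝ) (ζ : ℂ) :
    HasDerivAt (fun y : ℝ => airyPhase y ζ) (Complex.I * ζ * airyPhase x ζ) x := by
  have h : HasDerivAt (fun y : ℂ => Complex.exp (Complex.I * (ζ ^ 3 / 3 + y * ζ)))
      (Complex.I * ζ * airyPhase x ζ) (x : ℂ) := by
    refine ((((hasDerivAt_id (x : ℂ)).mul_const ζ).const_add (ζ ^ 3 / 3)).const_mul
      Complex.I).cexp.congr_deriv ?_
    simp [airyPhase]; ring
  exact h.comp_ofReal

lemma hasDerivAt_airyPhase (x : ℝ) (ζ : ℂ) :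
    HasDerivAt (airyPhase x) (Complex.I * (ζ ^ 2 + x) * airyPhase x ζ) ζ := by
  refine ((((hasDerivAt_pow 3 ζ).div_const 3).add
    ((hasDerivAt_id ζ).const_mul (x : ℂ))).const_mul Complex.I).cexp.congr_deriv ?_
  simp [airyPhase]; ring

lemma hasDerivAt_airyMoment (k : ℕ) (x : ℝ) :
    HasDerivAt (airyMoment k) (airyMoment (k + 1) x) x := by
  refine (hasDerivAt_integral_of_dominated_loc_of_deriv_le (μ := volume) (s := Metric.ball x 1)
    (bound := fun t : ℝ => Real.exp (1 - (x - 1)) * ((1 + t ^ 2) ^ (k + 1) * Real.exp (-1 * t ^ 2)))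
    (F := fun y t => (Complex.I * horizontal 1 t) ^ k * airyPhase y (horizontal 1 t))
    (F' := fun y t => (Complex.I * horizontal 1 t) ^ (k + 1) * airyPhase y (horizontal 1 t))
    (Metric.ball_mem_nhds x one_pos)
    (Eventually.of_forall fun y => (integrable_airyMoment_integrand k y).aestronglyMeasurable)
    (integrable_airyMoment_integrand k x)
    (integrable_airyMoment_integrand (k + 1) x).aestronglyMeasurable
    (ae_of_all _ fun t y hy => ?_)
    ((integrable_const_add_sq_pow_mul_exp one_pos 1 (k + 1)).const_mul _)
    (ae_of_all _ fun t y hy => ?_)).2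
  · refine (norm_airyMoment_integrand_le (k + 1) y t).trans ?_
    have : x - 1 ≤ y := by
      rw [Metric.mem_ball, Real.dist_eq, abs_lt] at hy; linarith
    gcongr
  · refine ((hasDerivAt_airyPhase_left y (horizontal 1 t)).const_mul
      ((Complex.I * horizontal 1 t) ^ k)).congr_deriv ?_
    ring

lemma hasDerivAt_horizontal (η t : ℝ) : HasDerivAt (horizontal η) 1 t := by
  exact ((hasDerivAt_id (t : ℂ)).add_const ((η : ℂ) * Complex.I)).comp_ofReal

lemma integrable_airyPhase {η : ℝ} (hη : 0 < η) (x : ℝ) :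
    Integrable fun t => airyPhase x (horizontal η t) := by
  refine ((integrable_exp_neg_mul_sq hη).const_mul (Real.exp (η ^ 3 / 3 - x * η))).mono'
    (by fun_prop) (ae_of_all _ fun t => ?_)
  rw [norm_airyPhase, Real.exp_add, mul_comm]

lemma norm_deriv_airyPhase_le {a b η : ℝ} (ha : 0 < a) (h : a ≤ η) (h' : η ≤ b) (x t : ℝ) :
    ‖Complex.I * (horizontal η t ^ 2 + x) * airyPhase x (horizontal η t)‖ ≤
      Real.exp (b ^ 3 / 3 + |x| * b) * ((b ^ 2 + |x| + t ^ 2) ^ 1 * Real.exp (-a * t ^ 2)) := by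
  have hη : 0 < η := ha.trans_le h
  rw [norm_mul, norm_mul, Complex.norm_I, one_mul, norm_airyPhase, Real.exp_add, pow_one]
  have h1 : ‖horizontal η t ^ 2 + x‖ ≤ b ^ 2 + |x| + t ^ 2 := by
    refine (norm_add_le _ _).trans ?_
    rw [norm_pow, norm_horizontal_sq, Complex.norm_real, Real.norm_eq_abs]
    nlinarith
  have h2 : -x * η ≤ |x| * b := by
    nlinarith [neg_abs_le x, abs_nonneg x]
  calc _ ≤ (b ^ 2 + |x| + t ^ 2) * (Real.exp (-a * t ^ 2) * Real.exp (b ^ 3 / 3 + |x| * b)) := by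
        have := pow_le_pow_left₀ hη.le h' 3
        gcongr
        linarith
    _ = _ := by ring

lemma integrable_deriv_airyPhase {η : ℝ} (hη : 0 < η) (x : ℝ) :
    Integrable fun t => Complex.I * (horizontal η t ^ 2 + x) * airyPhase x (horizontal η t) :=
  ((integrable_const_add_sq_pow_mul_exp hη _ 1).const_mul _).mono'
    (by fun_prop) (ae_of_all _ (norm_deriv_airyPhase_le hη le_rfl le_rfl x))

lemma integral_deriv_airyPhase {η : ℝ} (hη : 0 < η) (x : ℝ) :
    ∫ t, Complex.I * (horizontal η t ^ 2 + x) * airyPhase x (horizontal η t) = 0 := by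
  refine integral_eq_zero_of_hasDerivAt_of_integrable (fun t => ?_)
    (integrable_deriv_airyPhase hη x) (integrable_airyPhase hη x)
  exact ((hasDerivAt_airyPhase x (horizontal η t)).comp t
    (hasDerivAt_horizontal η t)).congr_deriv (mul_one _)

/-- The integrand is holomorphic in t + iη, so its η-derivative is i times its t-derivative, and the
latter integrates to zero over the line. -/
lemma hasDerivAt_integral_airyPhase {η : ℝ} (hη : 0 < η) (x : ℝ) :
    HasDerivAt (fun η' => ∫ t, airyPhase x (horizontal η' t)) 0 η := by
  have hmem : Ioo (η / 2) (2 * η) ∈ 𝓝 η := Ioo_mem_nhds (by linarith) (by linarith)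
  have hint := ((integrable_const_add_sq_pow_mul_exp (half_pos hη)
      ((2 * η) ^ 2 + |x|) 1).const_mul (Real.exp ((2 * η) ^ 3 / 3 + |x| * (2 * η))))
  have key := (hasDerivAt_integral_of_dominated_loc_of_deriv_le (μ := volume)
    (F := fun η' t => airyPhase x (horizontal η' t))
    (F' := fun η' t => Complex.I *
      (Complex.I * (horizontal η' t ^ 2 + x) * airyPhase x (horizontal η' t)))
    hmem
    (Eventually.of_forall fun η' => by fun_prop)
    (integrable_airyPhase hη x)
    (by fun_prop)
    (ae_of_all _ fun t y hy => by
      rw [norm_mul, Complex.norm_I, one_mul]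
      exact norm_deriv_airyPhase_le (half_pos hη) hy.1.le hy.2.le x t) hint
    (ae_of_all _ fun t y hy => ?_)).2
  · rwa [integral_const_mul, integral_deriv_airyPhase hη, mul_zero] at key
  · have h : HasDerivAt (fun η' : ℝ => horizontal η' t) Complex.I y := by
      exact ((((hasDerivAt_id (y : ℂ)).mul_const Complex.I).const_add
        (t : ℂ)).comp_ofReal).congr_deriv (one_mul _)
    refine ((hasDerivAt_airyPhase x (horizontal y t)).comp y h).congr_deriv ?_
    ring

/-- The contour of the Airy integral can be moved in the upper half plane. -/
lemma integral_airyPhase_eq {η : ℝ} (hη : 0 < η) (x : ℝ) :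
    ∫ t, airyPhase x (horizontal η t) = ∫ t, airyPhase x (horizontal 1 t) := by
  refine (convex_Ioi (0 : ℝ)).is_const_of_fderivWithin_eq_zero (𝕜 := ℝ)
    (f := fun η' => ∫ t, airyPhase x (horizontal η' t))
    (fun y hy => (hasDerivAt_integral_airyPhase hy x).differentiableAt.differentiableWithinAt)
    (fun y hy => ?_) hη (mem_Ioi.2 one_pos)
  have := (hasDerivAt_integral_airyPhase hy x).hasFDerivAt.hasFDerivWithinAt (s := Ioi 0)
  rw [this.fderivWithin (uniqueDiffOn_Ioi 0 y hy)]
  ext; simp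

/-- i(ζ² + x) times the integrand is its ζ-derivative, which integrates to zero. This is the Airy
equation before taking real parts. -/
lemma airyMoment_two (x : ℝ) : airyMoment 2 x = x * airyMoment 0 x := by
  have h := integral_deriv_airyPhase one_pos x
  have h2 := integrable_airyMoment_integrand 2 x
  have h0 := integrable_airyMoment_integrand 0 x
  have : (fun t => Complex.I * (horizontal 1 t ^ 2 + x) * airyPhase x (horizontal 1 t)) =
      fun t => (-Complex.I) * ((Complex.I * horizontal 1 t) ^ 2 * airyPhase x (horizontal 1 t)) +
        (Complex.I * x) * ((Complex.I * horizontal 1 t) ^ 0 * airyPhase x (horizontal 1 t)) := by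
    funext t
    linear_combination (Complex.I * horizontal 1 t ^ 2 * airyPhase x (horizontal 1 t)) * Complex.I_sq
  rw [this, integral_add (h2.const_mul _) (h0.const_mul _), integral_const_mul,
    integral_const_mul] at h
  change -Complex.I * airyMoment 2 x + Complex.I * x * airyMoment 0 x = 0 at h
  linear_combination Complex.I * h + (airyMoment 2 x - x * airyMoment 0 x) * Complex.I_sq

lemma airyMoment_zero (x : ℝ) : airyMoment 0 x = ∫ t, airyPhase x (horizontal 1 t) := by
  simp [airyMoment]

lemma airyAi_eq_re (x : ℝ) : airyAi x = 1 / (2 * Real.pi) * (airyMoment 0 x).re := by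
  simp [airyAi, airyMoment_zero, airyPhase, horizontal]

lemma conj_airyMoment_zero (x : ℝ) : starRingEnd ℂ (airyMoment 0 x) = airyMoment 0 x := by
  rw [airyMoment_zero, ← integral_conj, ← integral_neg_eq_self]
  refine integral_congr_ae (ae_of_all _ fun t => ?_)
  simp only [airyPhase, horizontal, ← Complex.exp_conj]
  congr 1
  simp
  rw [map_ofNat]
  ring

lemma ofReal_airyAi (x : ℝ) :
    (airyAi x : ℂ) = 1 / (2 * Real.pi) * ∫ t, airyPhase x (horizontal 1 t) := by
  rw [airyAi_eq_re, ← airyMoment_zero]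
  push_cast
  rw [Complex.conj_eq_iff_re.1 (conj_airyMoment_zero x)]

lemma hasDerivAt_re_airyMoment (k : ℕ) (x : ℝ) :
    HasDerivAt (fun y => 1 / (2 * Real.pi) * (airyMoment k y).re)
      (1 / (2 * Real.pi) * (airyMoment (k + 1) x).re) x :=
  ((Complex.reCLM.hasFDerivAt.comp_hasDerivAt x (hasDerivAt_airyMoment k x))).const_mul _

lemma deriv_airyAi : deriv airyAi = fun x => 1 / (2 * Real.pi) * (airyMoment 1 x).re := by
  funext x
  rw [funext airyAi_eq_re]
  exact (hasDerivAt_re_airyMoment 0 x).deriv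

lemma hasDerivAt_airyAi (x : ℝ) : HasDerivAt airyAi (deriv airyAi x) x := by
  rw [deriv_airyAi, funext airyAi_eq_re]
  exact hasDerivAt_re_airyMoment 0 x

/-- The Airy differential equation `Ai'' = x Ai`. -/
lemma hasDerivAt_deriv_airyAi (x : ℝ) : HasDerivAt (deriv airyAi) (x * airyAi x) x := by
  rw [deriv_airyAi]
  convert hasDerivAt_re_airyMoment 1 x using 1
  rw [airyMoment_two, airyAi_eq_re]
  simp
  ring

@[fun_prop]
lemma continuous_airyAi : Continuous airyAi :=
  continuous_iff_continuousAt.2 fun x => (hasDerivAt_airyAi x).continuousAt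

lemma exists_abs_re_airyMoment_le (k : ℕ) :
    ∃ C, 0 ≤ C ∧ ∀ x, |1 / (2 * Real.pi) * (airyMoment k x).re| ≤ C * Real.exp (-x) := by
  obtain ⟨C, hC, h⟩ := exists_norm_airyMoment_le k
  refine ⟨1 / (2 * Real.pi) * C, by positivity, fun x => ?_⟩
  rw [abs_mul, abs_of_nonneg (by positivity : 0 ≤ 1 / (2 * Real.pi)), mul_assoc]
  gcongr
  exact (Complex.abs_re_le_norm _).trans (h x)

lemma exists_abs_airyAi_le : ∃ C, 0 ≤ C ∧ ∀ x, |airyAi x| ≤ C * Real.exp (-x) := by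
  simpa only [airyAi_eq_re] using exists_abs_re_airyMoment_le 0

lemma exists_abs_deriv_airyAi_le : ∃ C, 0 ≤ C ∧ ∀ x, |deriv airyAi x| ≤ C * Real.exp (-x) := by
  simpa only [deriv_airyAi] using exists_abs_re_airyMoment_le 1

/-! ### Factorization of the Airy kernel -/

lemma integrableOn_exp_neg_sub (x y : ℝ) :
    IntegrableOn (fun z => Real.exp (-(x + z)) * Real.exp (-(y + z))) (Ioi 0) := by
  have := (integrableOn_exp_mul_Ioi (by norm_num : (-2 : ℝ) < 0) 0).const_mul (Real.exp (-x - y))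
  refine IntegrableOn.congr_fun this (fun z _ => ?_) measurableSet_Ioi
  simp only [← Real.exp_add]
  ring_nf

lemma integrableOn_airyAi_mul_airyAi (x y : ℝ) :
    IntegrableOn (fun z => airyAi (x + z) * airyAi (y + z)) (Ioi 0) := by
  obtain ⟨C, hC, h⟩ := exists_abs_airyAi_le
  refine ((integrableOn_exp_neg_sub x y).const_mul (C * C)).mono'
    (by fun_prop) (ae_of_all _ fun z => ?_)
  rw [Real.norm_eq_abs, abs_mul]
  calc _ ≤ (C * Real.exp (-(x + z))) * (C * Real.exp (-(y + z))) := by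
        gcongr <;> exact h _
    _ = _ := by ring

lemma tendsto_add_mul_mul_of_le_exp {f g : ℝ → ℝ} {C D : ℝ}
    (hC : 0 ≤ C) (hf : ∀ x, |f x| ≤ C * Real.exp (-x))
    (hg : ∀ x, |g x| ≤ D * Real.exp (-x)) (x y c : ℝ) :
    Tendsto (fun z => (c + z) * (f (x + z) * g (y + z))) atTop (𝓝 0) := by
  have h1 : Tendsto (fun z => Real.exp (-z)) atTop (𝓝 0) := Real.tendsto_exp_neg_atTop_nhds_zero
  have h2 : Tendsto (fun z => z * Real.exp (-z)) atTop (𝓝 0) := by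
    simpa using Real.tendsto_pow_mul_exp_neg_atTop_nhds_zero 1
  have h3 : Tendsto (fun z => (C * D * Real.exp (-x - y)) *
      ((|c| * Real.exp (-z) + |z * Real.exp (-z)|) * Real.exp (-z))) atTop (𝓝 0) := by
    have := (((h1.const_mul |c|).add h2.abs).mul h1).const_mul (C * D * Real.exp (-x - y))
    simpa using this
  refine squeeze_zero_norm (fun z => ?_) h3
  rw [Real.norm_eq_abs, abs_mul, abs_mul, abs_mul z, Real.abs_exp]
  calc _ ≤ (|c| + |z|) * ((C * Real.exp (-(x + z))) * (D * Real.exp (-(y + z)))) := by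
        gcongr
        · exact abs_add_le _ _
        · exact hf _
        · exact hg _
    _ = _ := by
        rw [show -(x + z) = -x + -z by ring, show -(y + z) = -y + -z by ring,
          show -x - y = -x + -y by ring]
        simp only [Real.exp_add]
        ring

lemma tendsto_mul_of_le_exp {f g : ℝ → ℝ} {C D : ℝ}
    (hC : 0 ≤ C) (hf : ∀ x, |f x| ≤ C * Real.exp (-x))
    (hg : ∀ x, |g x| ≤ D * Real.exp (-x)) (x y : ℝ) :
    Tendsto (fun z => f (x + z) * g (y + z)) atTop (𝓝 0) := by
  have := (tendsto_add_mul_mul_of_le_exp hC hf hg x y 1).sub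
    (tendsto_add_mul_mul_of_le_exp hC hf hg x y 0)
  rw [sub_zero] at this
  exact this.congr fun z => by ring

/-- The Airy kernel is the square of the Airy transform restricted to a half line. -/
lemma airyKernel_eq_integral (x y : ℝ) :
    airyKernel x y = ∫ z in Ioi 0, airyAi (x + z) * airyAi (y + z) := by
  obtain ⟨C, hC, hA⟩ := exists_abs_airyAi_le
  obtain ⟨D, hD, hA'⟩ := exists_abs_deriv_airyAi_le
  have hd (c z : ℝ) : HasDerivAt (fun z => airyAi (c + z)) (deriv airyAi (c + z)) z :=
    (hasDerivAt_airyAi (c + z)).comp_const_add c z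
  have hd' (c z : ℝ) : HasDerivAt (fun z => deriv airyAi (c + z)) ((c + z) * airyAi (c + z)) z :=
    (hasDerivAt_deriv_airyAi (c + z)).comp_const_add c z
  by_cases hxy : x = y
  · subst hxy
    -- By Ai'' = x Ai, the terms 2(x+z) Ai Ai' cancel and only Ai² survives.
    have hder : ∀ z ∈ Ici (0 : ℝ), HasDerivAt (fun z => (x + z) * (airyAi (x + z) * airyAi (x + z))
        - deriv airyAi (x + z) * deriv airyAi (x + z)) (airyAi (x + z) * airyAi (x + z)) z := by
      intro z _
      refine ((((hasDerivAt_id z).const_add x).mul ((hd x z).mul (hd x z))).sub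
        ((hd' x z).mul (hd' x z))).congr_deriv ?_
      simp only [id, Pi.mul_apply]
      ring
    rw [integral_Ioi_of_hasDerivAt_of_tendsto' hder (integrableOn_airyAi_mul_airyAi x x)
      ((tendsto_add_mul_mul_of_le_exp hC hA hA x x x).sub
        (tendsto_mul_of_le_exp hD hA' hA' x x))]
    simp [airyKernel]
    ring
  · have hne : x - y ≠ 0 := sub_ne_zero.2 hxy
    -- The derivative of this Wronskian-type numerator is ((x+z) - (y+z)) Ai(x+z) Ai(y+z), as the
    -- Ai' Ai' terms cancel.
    have hder : ∀ z ∈ Ici (0 : ℝ), HasDerivAt (fun z =>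
        (deriv airyAi (x + z) * airyAi (y + z) - airyAi (x + z) * deriv airyAi (y + z)) / (x - y))
        (airyAi (x + z) * airyAi (y + z)) z := by
      intro z _
      refine ((((hd' x z).mul (hd y z)).sub ((hd x z).mul (hd' y z))).div_const
        (x - y)).congr_deriv ?_
      field_simp
      ring
    rw [integral_Ioi_of_hasDerivAt_of_tendsto' hder (integrableOn_airyAi_mul_airyAi x y)
      (((tendsto_mul_of_le_exp hD hA' hA x y).sub
        (tendsto_mul_of_le_exp hC hA hA' x y)).div_const (x - y))]
    simp [airyKernel, hxy]
    field_simp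
    ring

/-! ### The Airy transform as a unitary Fourier multiplier -/

lemma iteratedDeriv_cexp_ofReal_mul_I (k : ℕ) :
    iteratedDeriv k (fun y : ℝ => Complex.exp (y * Complex.I)) =
      fun y : ℝ => Complex.I ^ k * Complex.exp (y * Complex.I) := by
  induction k with
  | zero => simp
  | succ k ih =>
    rw [iteratedDeriv_succ, ih]
    funext y
    have h : HasDerivAt (fun y : ℝ => Complex.exp (y * Complex.I))
        (Complex.exp (y * Complex.I) * (1 * Complex.I)) y :=
      ((hasDerivAt_id (y : ℂ)).mul_const Complex.I).cexp.comp_ofReal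
    rw [(h.const_mul (Complex.I ^ k)).deriv]
    ring

lemma hasTemperateGrowth_cexp_ofReal_mul_I :
    Function.HasTemperateGrowth (fun y : ℝ => Complex.exp (y * Complex.I)) := by
  refine ⟨(Complex.ofRealCLM.contDiff.mul contDiff_const).cexp, fun k => ⟨0, 1, fun y => ?_⟩⟩
  rw [norm_iteratedFDeriv_eq_norm_iteratedDeriv, iteratedDeriv_cexp_ofReal_mul_I]
  simp [Complex.norm_exp_ofReal_mul_I]

/-- The Fourier symbol `exp (i (t + iη)³ / 3)`, `t = -2πu`, of `x ↦ exp (ηx) Ai(x)`. -/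
noncomputable def airySymbol (η u : ℝ) : ℂ := airyPhase 0 (horizontal η (-2 * Real.pi * u))

@[fun_prop]
lemma continuous_airySymbol (η : ℝ) : Continuous (airySymbol η) := by
  unfold airySymbol; fun_prop

lemma norm_airySymbol_le {η : ℝ} (hη : 0 ≤ η) (u : ℝ) :
    ‖airySymbol η u‖ ≤ Real.exp (η ^ 3 / 3) := by
  rw [airySymbol, norm_airyPhase]
  gcongr
  nlinarith [mul_nonneg hη (sq_nonneg (-2 * Real.pi * u))]

lemma norm_airySymbol_zero (u : ℝ) : ‖airySymbol 0 u‖ = 1 := by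
  simp [airySymbol, norm_airyPhase]

lemma hasTemperateGrowth_airySymbol_zero : Function.HasTemperateGrowth (airySymbol 0) := by
  have h : Function.HasTemperateGrowth
      (fun u : ℝ => (-2 * Real.pi) ^ 3 / 3 * u ^ 3) :=
    (Function.HasTemperateGrowth.const _).mul (Function.HasTemperateGrowth.id'.pow 3)
  convert hasTemperateGrowth_cexp_ofReal_mul_I.comp h using 1
  funext u
  simp only [airySymbol, airyPhase, horizontal, Function.comp]
  congr 1
  push_cast
  ring

lemma tendsto_airySymbol (u : ℝ) :
    Tendsto (fun η => airySymbol η u) (𝓝[>] 0) (𝓝 (airySymbol 0 u)) := by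
  have : Continuous fun η => airySymbol η u := by
    unfold airySymbol airyPhase horizontal; fun_prop
  exact (this.tendsto 0).mono_left nhdsWithin_le_nhds

lemma integrable_airySymbol {η : ℝ} (hη : 0 < η) : Integrable (airySymbol η) :=
  (integrable_airyPhase hη 0).comp_mul_left' (by simp [Real.pi_ne_zero])

lemma airyPhase_horizontal_eq (y η t : ℝ) :
    Complex.exp (η * y) * airyPhase y (horizontal η t) =
      airyPhase 0 (horizontal η t) * Complex.exp (y * t * Complex.I) := by
  simp only [airyPhase, horizontal, ← Complex.exp_add, Complex.ofReal_zero]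
  congr 1
  linear_combination (η * y : ℂ) * Complex.I_sq

/-- With Ai written on the contour at height η, the substitution t = -2πu has a Jacobian that
absorbs the factor 1/(2π). -/
lemma fourier_airySymbol {η : ℝ} (hη : 0 < η) (y : ℝ) :
    𝓕 (airySymbol η) y = Complex.exp (η * y) * airyAi y := by
  rw [ofReal_airyAi, ← integral_airyPhase_eq hη, Real.fourier_real_eq_integral_exp_smul,
    mul_left_comm, ← integral_const_mul]
  simp only [airyPhase_horizontal_eq]
  have := Measure.integral_comp_mul_left (fun t : ℝ =>
    airyPhase 0 (horizontal η t) * Complex.exp (y * t * Complex.I)) (-2 * Real.pi)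
  rw [show |(-2 * Real.pi)⁻¹| = 1 / (2 * Real.pi) by
    rw [abs_inv, abs_mul, abs_of_pos Real.pi_pos]; norm_num, Complex.real_smul] at this
  push_cast at this
  rw [← this]
  refine integral_congr_ae (ae_of_all _ fun u => ?_)
  simp only [airySymbol, smul_eq_mul]
  rw [mul_comm]
  congr 2
  push_cast
  ring

lemma fourier_mul_exp (f : ℝ → ℂ) (x z : ℝ) :
    𝓕 (fun u : ℝ => Complex.exp ((-2 * Real.pi * u * x : ℝ) * Complex.I) * f u) z =
      𝓕 f (x + z) := by
  rw [Real.fourier_real_eq_integral_exp_smul, Real.fourier_real_eq_integral_exp_smul]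
  refine integral_congr_ae (ae_of_all _ fun u => ?_)
  simp only [smul_eq_mul]
  rw [← mul_assoc, ← Complex.exp_add]
  congr 2
  push_cast
  ring

/-- The Fourier transform is moved from the symbol to `w`; this needs an integrable symbol, hence η
> 0. -/
lemma integral_exp_mul_airyAi_mul (w : 𝓢(ℝ, ℂ)) {η : ℝ} (hη : 0 < η) (x : ℝ) :
    ∫ z, Complex.exp (η * (x + z : ℝ)) * airyAi (x + z) * w z =
      ∫ u, Complex.exp ((-2 * Real.pi * u * x : ℝ) * Complex.I) * (airySymbol η u * 𝓕 w u) := by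
  have hint : Integrable
      (fun u : ℝ => Complex.exp ((-2 * Real.pi * u * x : ℝ) * Complex.I) * airySymbol η u) := by
    refine (integrable_airySymbol hη).bdd_mul (c := 1) (by fun_prop) (ae_of_all _ fun u => ?_)
    rw [Complex.norm_exp_ofReal_mul_I]
  have key := VectorFourier.integral_fourierIntegral_smul_eq_flip (L := innerₗ ℝ)
    Real.continuous_fourierChar continuous_inner hint w.integrable (μ := volume) (ν := volume)
  calc _ = ∫ z, 𝓕 (fun u : ℝ => Complex.exp ((-2 * Real.pi * u * x : ℝ) * Complex.I) *
        airySymbol η u) z • w z := by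
        simp_rw [fourier_mul_exp, fourier_airySymbol hη, smul_eq_mul]
    _ = ∫ u, (Complex.exp ((-2 * Real.pi * u * x : ℝ) * Complex.I) * airySymbol η u) •
          𝓕 w u := by
        rw [flip_innerₗ] at key
        exact key
    _ = _ := by simp only [smul_eq_mul, mul_assoc]

/-- Limit η → 0⁺ by dominated convergence. Compact support of `w` controls exp(η(x+z)) on the left;
on the right the symbols are uniformly bounded and 𝓕 w is integrable. -/
lemma integral_airyAi_mul_eq (w : 𝓢(ℝ, ℂ)) (hw : HasCompactSupport w) (x : ℝ) :
    ∫ z, (airyAi (x + z) : ℂ) * w z =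
      ∫ u, Complex.exp ((-2 * Real.pi * u * x : ℝ) * Complex.I) * (airySymbol 0 u * 𝓕 w u) := by
  have h01 : ∀ᶠ η : ℝ in 𝓝[>] 0, η ∈ Ioo (0 : ℝ) 1 := Ioo_mem_nhdsGT one_pos
  have h1 : Tendsto (fun η : ℝ => ∫ z, Complex.exp (η * (x + z : ℝ)) * airyAi (x + z) * w z)
      (𝓝[>] 0) (𝓝 (∫ z, (airyAi (x + z) : ℂ) * w z)) := by
    refine tendsto_integral_filter_of_dominated_convergence
      (fun z => Real.exp |x + z| * |airyAi (x + z)| * ‖w z‖)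
      (Eventually.of_forall fun η => ?_) ?_ ?_ (ae_of_all _ fun z => ?_)
    · exact Continuous.aestronglyMeasurable (by fun_prop)
    · filter_upwards [h01] with η hη
      refine ae_of_all _ fun z => ?_
      rw [norm_mul, norm_mul, Complex.norm_real, Real.norm_eq_abs, ← Complex.ofReal_mul,
        Complex.norm_exp_ofReal]
      gcongr
      nlinarith [le_abs_self (x + z), abs_nonneg (x + z), hη.1, hη.2]
    · exact Continuous.integrable_of_hasCompactSupport (by fun_prop) hw.norm.mul_left
    · have : Continuous fun η : ℝ => Complex.exp (η * (x + z : ℝ)) * airyAi (x + z) * w z := by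
        fun_prop
      simpa using (this.tendsto 0).mono_left (nhdsWithin_le_nhds (s := Ioi 0))
  have h2 : Tendsto (fun η : ℝ => ∫ u, Complex.exp ((-2 * Real.pi * u * x : ℝ) * Complex.I) *
      (airySymbol η u * 𝓕 w u)) (𝓝[>] 0) (𝓝 (∫ u,
        Complex.exp ((-2 * Real.pi * u * x : ℝ) * Complex.I) * (airySymbol 0 u * 𝓕 w u))) := by
    refine tendsto_integral_filter_of_dominated_convergence
      (fun u => Real.exp (1 / 3) * ‖𝓕 w u‖)
      (Eventually.of_forall fun η => ?_) ?_ ?_ (ae_of_all _ fun u => ?_)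
    · exact Continuous.aestronglyMeasurable (by fun_prop)
    · filter_upwards [h01] with η hη
      refine ae_of_all _ fun u => ?_
      rw [norm_mul, norm_mul, Complex.norm_exp_ofReal_mul_I, one_mul]
      gcongr
      refine (norm_airySymbol_le hη.1.le u).trans ?_
      gcongr
      exact pow_le_one₀ hη.1.le hη.2.le
    · exact (𝓕 w).integrable.norm.const_mul _
    · exact ((tendsto_airySymbol u).mul_const _).const_mul _
  refine tendsto_nhds_unique h1 (h2.congr' ?_)
  filter_upwards [h01] with η hη
  exact (integral_exp_mul_airyAi_mul w hη.1 x).symm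

/-- The Airy transform `w ↦ ∫ Ai(· + z) w(z) dz` of a test function. -/
noncomputable def airyTransform (w : ℝ → ℝ) (x : ℝ) : ℝ := ∫ z, airyAi (x + z) * w z

lemma exists_schwartzMap_eq_airyTransform {w : ℝ → ℝ} (hw : ContDiff ℝ ∞ w)
    (hc : HasCompactSupport w) : ∃ W : 𝓢(ℝ, ℂ), (∀ x, W x = airyTransform w x) ∧
      ∫ x, ‖W x‖ ^ 2 = ∫ x, w x ^ 2 := by
  have hc' : HasCompactSupport (fun x => (w x : ℂ)) := hc.comp_left (g := Complex.ofReal) rfl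
  let w' : 𝓢(ℝ, ℂ) := hc'.toSchwartzMap (Complex.ofRealCLM.contDiff.comp hw)
  have hw' (x) : w' x = w x := rfl
  -- The symbol at η = 0 has modulus one and temperate growth, so the product stays Schwartz and
  -- Plancherel, used twice, gives the norm identity.
  refine ⟨𝓕 (SchwartzMap.smulLeftCLM ℂ (airySymbol 0) (𝓕 w')), fun x => ?_, ?_⟩
  · rw [SchwartzMap.fourier_coe, Real.fourier_real_eq_integral_exp_smul]
    simp only [SchwartzMap.smulLeftCLM_apply_apply hasTemperateGrowth_airySymbol_zero, smul_eq_mul]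
    rw [← integral_airyAi_mul_eq w' hc', airyTransform, ← integral_complex_ofReal]
    simp [hw']
  · rw [SchwartzMap.integral_norm_sq_fourier]
    simp only [SchwartzMap.smulLeftCLM_apply_apply hasTemperateGrowth_airySymbol_zero, smul_eq_mul,
      norm_mul, norm_airySymbol_zero, one_mul]
    rw [SchwartzMap.integral_norm_sq_fourier]
    simp [hw']

lemma memLp_airyTransform {w : ℝ → ℝ} (hw : ContDiff ℝ ∞ w) (hc : HasCompactSupport w) :
    MemLp (airyTransform w) 2 := by
  obtain ⟨W, hW, -⟩ := exists_schwartzMap_eq_airyTransform hw hc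
  have : airyTransform w = fun x => RCLike.re (W x) := by
    funext x; rw [hW]; simp
  rw [this]
  exact (W.memLp 2 volume).re

/-- The Airy transform preserves the `L²` norm. -/
lemma integral_sq_airyTransform {w : ℝ → ℝ} (hw : ContDiff ℝ ∞ w) (hc : HasCompactSupport w) :
    ∫ x, airyTransform w x ^ 2 = ∫ x, w x ^ 2 := by
  obtain ⟨W, hW, h⟩ := exists_schwartzMap_eq_airyTransform hw hc
  rw [← h]
  simp [hW]

/-! ### Eigenvalue counting for compact symmetric operators -/

section CompactSymmetric

variable {H : Type*} [NormedAddCommGroup H] [InnerProductSpace ℝ H]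

/-- A compact symmetric operator whose eigenvectors with eigenvalue `≥ r` are all orthogonal to
`w ≠ 0` satisfies `⟪T w, w⟫ < r ‖w‖²`. -/
lemma inner_apply_lt_of_orthogonal_eigenvectors [CompleteSpace H] {T : H →L[ℝ] H}
    (hT : IsCompactOperator T) (hT' : (T : H →ₗ[ℝ] H).IsSymmetric) {r : ℝ} {w : H} (hw : w ≠ 0)
    (horth : ∀ ν v, r ≤ ν → T v = ν • v → ⟪v, w⟫_ℝ = 0) :
    ⟪T w, w⟫_ℝ < r * ‖w‖ ^ 2 := by
  set V : ℝ → Submodule ℝ H := fun μ => Module.End.eigenspace (T : Module.End ℝ H) μ with hV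
  have hsum : IsHilbertSum ℝ (fun μ => V μ) fun μ => (V μ).subtypeₗᵢ := by
    have (μ : ℝ) : CompleteSpace (V μ) := by
      have : IsClosed (V μ : Set H) := by
        have : (V μ : Set H) = {x | T x = μ • x} := by
          ext x; simp [hV]
        rw [this]
        exact isClosed_eq T.continuous (continuous_const_smul μ)
      exact this.completeSpace_coe
    refine IsHilbertSum.mkInternal V hT'.orthogonalFamily_eigenspaces ?_
    rw [Submodule.topologicalClosure_eq_top_iff.2
      (ContinuousLinearMap.orthogonalComplement_iSup_eigenspaces_eq_bot hT hT')]
  set c := hsum.linearIsometryEquiv w with hc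
  have hcw : HasSum (fun μ => (c μ : H)) w := by
    simpa [hc] using hsum.hasSum_linearIsometryEquiv_symm c
  have hTc (μ : ℝ) : T (c μ : H) = μ • (c μ : H) := Module.End.mem_eigenspace_iff.1 (c μ).2
  have hself (μ : ℝ) : ⟪(c μ : H), w⟫_ℝ = ‖(c μ : H)‖ ^ 2 := by
    have h1 := hcw.mapL (innerSL ℝ (c μ : H))
    have h2 := hasSum_single (f := fun ν => innerSL ℝ (c μ : H) (c ν : H)) μ fun ν hν => by
      simpa using hT'.orthogonalFamily_eigenspaces hν.symm (c μ) (c ν)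
    simpa using h1.unique h2
  have h1 : HasSum (fun μ => r * ⟪(c μ : H), w⟫_ℝ) (r * ‖w‖ ^ 2) := by
    have := (hcw.mapL (innerSL ℝ w)).mul_left r
    simpa [real_inner_comm] using this
  have h2 : HasSum (fun μ => μ * ⟪(c μ : H), w⟫_ℝ) ⟪T w, w⟫_ℝ := by
    have := (hcw.mapL T).mapL (innerSL ℝ w)
    simpa [hTc, real_inner_comm, inner_smul_right] using this
  -- Components with μ ≥ r vanish by orthogonality, and those with μ < r contribute less than r
  -- times their squared norm. As w ≠ 0, some component is nonzero, which makes the comparison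
  -- strict.
  have hle (μ : ℝ) : μ * ⟪(c μ : H), w⟫_ℝ ≤ r * ⟪(c μ : H), w⟫_ℝ := by
    rcases le_or_gt r μ with h | h
    · rw [horth μ _ h (hTc μ)]; simp
    · rw [hself]; gcongr
  obtain ⟨μ, hμ⟩ : ∃ μ, (c μ : H) ≠ 0 := by
    by_contra! h
    simp only [h] at hcw
    exact hw (hcw.unique hasSum_zero)
  refine hasSum_lt hle (i := μ) ?_ h2 h1
  have hpos : 0 < ⟪(c μ : H), w⟫_ℝ := by rw [hself]; positivity
  have : μ < r := by
    by_contra! h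
    exact hpos.ne' (horth μ _ h (hTc μ))
  exact mul_lt_mul_of_pos_right this hpos

/-- The basis of the span is drawn from `S` itself: a linear combination of eigenvectors need not be
an eigenvector. -/
lemma exists_linearIndependent_of_lt_finrank_of_subset {S : Set H} {n : ℕ}
    (h : ¬ (Module.Finite ℝ (Submodule.span ℝ S) ∧ Module.finrank ℝ (Submodule.span ℝ S) < n)) :
    ∃ f : Fin n → H, LinearIndependent ℝ f ∧ ∀ k, f k ∈ S := by
  obtain ⟨b, hbS, hspan, hb⟩ := exists_linearIndependent ℝ S
  have hcard : ∃ t : Finset H, (t : Set H) ⊆ b ∧ t.card = n := by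
    by_cases hfin : b.Finite
    · have : Fintype b := hfin.fintype
      have hfr : Module.finrank ℝ (Submodule.span ℝ S) = b.toFinset.card := by
        rw [← hspan, finrank_span_set_eq_card hb]
      have hn : n ≤ b.toFinset.card := by
        by_contra! hlt
        refine h ⟨?_, hfr ▸ hlt⟩
        rw [← hspan]
        exact FiniteDimensional.span_of_finite ℝ hfin
      obtain ⟨t, ht, htc⟩ := Finset.exists_subset_card_eq hn
      exact ⟨t, by simpa using Finset.coe_subset.2 ht, htc⟩
    · exact Set.Infinite.exists_subset_card_eq hfin n
  obtain ⟨t, htb, rfl⟩ := hcard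
  refine ⟨fun k => t.equivFin.symm k, ?_, fun k => hbS (htb (t.equivFin.symm k).2)⟩
  have h1 : LinearIndependent ℝ (fun x : (t : Set H) => (x : H)) := hb.comp (Set.inclusion htb) (Set.inclusion_injective htb)
  exact h1.comp _ t.equivFin.symm.injective

/-- If the quadratic form of a compact symmetric operator is at least `r ‖·‖²` on an
`n`-dimensional subspace, there are `n` independent eigenvectors with eigenvalues `≥ r`. -/
lemma exists_linearIndependent_eigenvectors [CompleteSpace H] {T : H →L[ℝ] H}
    (hT : IsCompactOperator T) (hT' : (T : H →ₗ[ℝ] H).IsSymmetric) {r : ℝ} {n : ℕ}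
    {v : Fin n → H} (hv : LinearIndependent ℝ v)
    (h : ∀ w ∈ Submodule.span ℝ (range v), r * ‖w‖ ^ 2 ≤ ⟪T w, w⟫_ℝ) :
    ∃ f : Fin n → H, LinearIndependent ℝ f ∧ ∀ k, ∃ ν, r ≤ ν ∧ T (f k) = ν • f k := by
  refine exists_linearIndependent_of_lt_finrank_of_subset
    (S := {x | ∃ ν, r ≤ ν ∧ T x = ν • x}) ?_
  set S : Set H := {x | ∃ ν, r ≤ ν ∧ T x = ν • x}
  rintro ⟨hfin, hlt⟩
  set V := Submodule.span ℝ (range v)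
  have hVfin : Module.finrank ℝ V = n := by
    simpa using finrank_span_eq_card hv
  have : FiniteDimensional ℝ V := FiniteDimensional.span_of_finite ℝ (finite_range v)
  -- Were the eigenvectors to span fewer than n dimensions, projection of `V` onto their span would
  -- kill some w ≠ 0 in `V`.
  have hker := LinearMap.ker_ne_bot_of_finrank_lt
    (f := ((Submodule.span ℝ S).orthogonalProjectionOnto : H →ₗ[ℝ] Submodule.span ℝ S) ∘ₗ V.subtype)
    (by rwa [hVfin])
  obtain ⟨w, hw, hw0⟩ := Submodule.exists_mem_ne_zero_of_ne_bot hker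
  have hw' : (w : H) ∈ (Submodule.span ℝ S)ᗮ := by
    simpa using hw
  refine (inner_apply_lt_of_orthogonal_eigenvectors hT hT' (r := r) (w := w) (by simpa using hw0)
    fun ν x hν hx => ?_).not_ge (h w w.2)
  exact (Submodule.mem_orthogonal _ _).1 hw' x (Submodule.subset_span ⟨ν, hν, hx⟩)

/-- A compact symmetric operator has finitely many eigenvalues above a positive level. -/
lemma finite_setOf_eigenvalue_ge {T : H →L[ℝ] H}
    (hT : IsCompactOperator T) (hT' : (T : H →ₗ[ℝ] H).IsSymmetric) {c : ℝ} (hc : 0 < c) :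
    {ν | c ≤ ν ∧ ∃ f, f ≠ 0 ∧ T f = ν • f}.Finite := by
  by_contra hinf
  set φ := Set.Infinite.natEmbedding _ hinf
  choose hge f hf0 hf using fun k => (φ k).2
  set e : ℕ → H := fun k => ‖f k‖⁻¹ • f k
  have he1 (k) : ‖e k‖ = 1 := by
    simp [e, norm_smul, hf0 k]
  have heT (k) : T (e k) = (φ k : ℝ) • e k := by
    change T (‖f k‖⁻¹ • f k) = _ • ‖f k‖⁻¹ • f k
    rw [map_smul, hf, smul_comm]
  clear_value e
  have horth {j k} (hjk : j ≠ k) : ⟪e j, e k⟫_ℝ = 0 := by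
    have h := hT' (e j) (e k)
    rw [ContinuousLinearMap.coe_coe, heT, heT, real_inner_smul_left, real_inner_smul_right] at h
    have hne : (φ j : ℝ) ≠ φ k := fun h => hjk (φ.injective (Subtype.ext h))
    have : ((φ j : ℝ) - φ k) * ⟪e j, e k⟫_ℝ = 0 := by linear_combination h
    exact (mul_eq_zero.1 this).resolve_left (sub_ne_zero.2 hne)
  obtain ⟨a, -, ψ, hψ, hlim⟩ := (hT.isCompact_closure_image_closedBall 1).tendsto_subseq
    (x := fun k => T (e k)) fun k => subset_closure ⟨e k, by simp [he1], rfl⟩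
  obtain ⟨N, hN⟩ := Metric.cauchySeq_iff.1 hlim.cauchySeq c hc
  have hlt := hN N le_rfl (N + 1) (Nat.le_succ N)
  have hne : ψ N ≠ ψ (N + 1) := (hψ (Nat.lt_succ_self N)).ne
  simp only [Function.comp, dist_eq_norm, heT] at hlt
  -- By Pythagoras the images of distinct `e k` are at distance at least √2 c, so no subsequence of
  -- them is Cauchy.
  have hsq : ‖(φ (ψ N) : ℝ) • e (ψ N) - (φ (ψ (N + 1)) : ℝ) • e (ψ (N + 1))‖ ^ 2 =
      (φ (ψ N) : ℝ) ^ 2 + (φ (ψ (N + 1)) : ℝ) ^ 2 := by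
    rw [norm_sub_sq_real, inner_smul_left, inner_smul_right, horth hne]
    simp [norm_smul, he1]
  nlinarith [hge (ψ N), hge (ψ (N + 1)), norm_nonneg
    ((φ (ψ N) : ℝ) • e (ψ N) - (φ (ψ (N + 1)) : ℝ) • e (ψ (N + 1)))]

/-- For a positive compact symmetric operator bounded by `M`, there is a largest `r` such that
at least `n + 1` eigenvalues, counted with multiplicity, are `≥ r`. -/
lemma isGreatest_sSup_eigenvalueLowerBounds [CompleteSpace H] {T : H →L[ℝ] H}
    (hT : IsCompactOperator T) (hT' : (T : H →ₗ[ℝ] H).IsSymmetric)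
    (hpos : ∀ x, 0 ≤ ⟪T x, x⟫_ℝ) {M : ℝ} (hM : ∀ x, ⟪T x, x⟫_ℝ ≤ M * ‖x‖ ^ 2) {n : ℕ}
    {v : Fin (n + 1) → H} (hv : LinearIndependent ℝ v) :
    IsGreatest {r : ℝ | ∃ f : Fin (n + 1) → H, LinearIndependent ℝ f ∧
        ∀ k, ∃ ν, r ≤ ν ∧ f k ≠ 0 ∧ T (f k) = ν • f k}
      (sSup {r : ℝ | ∃ f : Fin (n + 1) → H, LinearIndependent ℝ f ∧
        ∀ k, ∃ ν, r ≤ ν ∧ f k ≠ 0 ∧ T (f k) = ν • f k}) := by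
  set S := {r : ℝ | ∃ f : Fin (n + 1) → H, LinearIndependent ℝ f ∧
        ∀ k, ∃ ν, r ≤ ν ∧ f k ≠ 0 ∧ T (f k) = ν • f k}
  have h0 : (0 : ℝ) ∈ S := by
    obtain ⟨f, hf, h⟩ := exists_linearIndependent_eigenvectors hT hT' (r := 0) hv
      fun w _ => by simpa using hpos w
    exact ⟨f, hf, fun k => by
      obtain ⟨ν, hν, h⟩ := h k
      exact ⟨ν, hν, hf.ne_zero k, h⟩⟩
  have hbdd : BddAbove S := by
    refine ⟨M, ?_⟩
    rintro r ⟨f, -, h⟩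
    obtain ⟨ν, hν, hf, h⟩ := h 0
    refine hν.trans ?_
    have := hM (f 0)
    rw [h, inner_smul_left, real_inner_self_eq_norm_sq] at this
    exact le_of_mul_le_mul_right this (by positivity)
  refine ⟨?_, fun r hr => le_csSup hbdd hr⟩
  rcases (le_csSup hbdd h0).eq_or_lt with h | h
  · rwa [← h]
  set L := sSup S
  have hfin : ({ν | L / 2 ≤ ν ∧ ∃ f, f ≠ 0 ∧ T f = ν • f} ∩ Iio L).Finite :=
    (finite_setOf_eigenvalue_ge hT hT' (half_pos h)).inter_of_left _
  -- An interval (a, L) free of eigenvalues exists, so a family admissible for some r in (a, L] has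
  -- all its eigenvalues ≥ L.
  have hev : ∀ᶠ r in 𝓝[<] L, ∀ ν ∈ {ν | L / 2 ≤ ν ∧ ∃ f, f ≠ 0 ∧ T f = ν • f} ∩ Iio L, ν < r :=
    (hfin.eventually_all).2 fun ν hν => mem_nhdsWithin_of_mem_nhds (Ioi_mem_nhds hν.2)
  obtain ⟨a, ha, haL⟩ := (mem_nhdsLT_iff_exists_Ioo_subset).1
    (hev.and (Ioo_mem_nhdsLT (half_lt_self h)))
  obtain ⟨r, hrS, hr⟩ := exists_lt_of_lt_csSup ⟨0, h0⟩ ha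
  obtain ⟨f, hf, hk⟩ := hrS
  refine ⟨f, hf, fun k => ?_⟩
  obtain ⟨ν, hν, hne, hTf⟩ := hk k
  refine ⟨ν, ?_, hne, hTf⟩
  by_contra! hlt
  have hm : ν ∈ Ioo a L := ⟨hr.trans_le hν, hlt⟩
  have := haL hm
  exact lt_irrefl _ (this.1 ν ⟨⟨this.2.1.le, f k, hne, hTf⟩, hlt⟩)

end CompactSymmetric

/-! ### Hilbert–Schmidt and Carleman operators -/

section HilbertSchmidt

universe u

variable {H : Type u} {G : Type*} [NormedAddCommGroup H] [InnerProductSpace ℝ H]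
  [NormedAddCommGroup G] [InnerProductSpace ℝ G] [CompleteSpace G]

/-- An operator for which `∑ ‖T eᵢ‖²` is bounded over orthonormal families is compact. -/
lemma isCompactOperator_of_sum_norm_sq_le [CompleteSpace H] {T : H →L[ℝ] G} {C : ℝ}
    (hC : ∀ (ι : Type u) (e : ι → H), Orthonormal ℝ e → ∀ s : Finset ι,
      ∑ i ∈ s, ‖T (e i)‖ ^ 2 ≤ C) : IsCompactOperator T := by
  obtain ⟨ι, e, -⟩ := exists_hilbertBasis ℝ H
  have hsum : Summable fun i => ‖T (e i)‖ ^ 2 :=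
    summable_of_sum_le (fun _ => by positivity) (hC _ e e.orthonormal)
  classical
  -- Finite-rank truncations of `T`. Cauchy–Schwarz and Bessel bound ‖T - P s‖ by the square root of
  -- the tail of ∑ ‖T eᵢ‖².
  let P (s : Finset ι) : H →L[ℝ] G :=
    ∑ i ∈ s, (innerSL ℝ (e i)).smulRight (T (e i))
  have hP (s : Finset ι) : IsCompactOperator (P s) := by
    refine Submodule.sum_mem (compactOperator (RingHom.id ℝ) H G) fun i _ => ?_
    have : ((innerSL ℝ (e i)).smulRight (T (e i)) : H →L[ℝ] G) =
        (ContinuousLinearMap.toSpanSingleton ℝ (T (e i))).comp (innerSL ℝ (e i)) := by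
      ext x; simp
    rw [this]
    exact (isCompactOperator_of_locallyCompactSpace_rng
      (ContinuousLinearMap.toSpanSingleton ℝ (T (e i)))).comp_clm _
  refine isCompactOperator_of_tendsto (l := atTop) (F := P) ?_ (Eventually.of_forall hP)
  have htail := tendsto_tsum_compl_atTop_zero fun i => ‖T (e i)‖ ^ 2
  rw [tendsto_iff_norm_sub_tendsto_zero]
  have hsqrt : Tendsto (fun s : Finset ι => √(∑' i : {i // i ∉ s}, ‖T (e i)‖ ^ 2)) atTop (𝓝 0) := by
    simpa using htail.sqrt
  refine squeeze_zero (fun _ => norm_nonneg _) (fun s => ?_) hsqrt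
  rw [norm_sub_rev]
  refine ContinuousLinearMap.opNorm_le_bound _ (Real.sqrt_nonneg _) fun x => ?_
  have hx : HasSum (fun i => ⟪e i, x⟫_ℝ • T (e i)) (T x) := by
    have := (e.hasSum_repr x).mapL T
    simpa [e.repr_apply_apply] using this
  have hx' : HasSum (fun i : {i // i ∉ s} => ⟪e i, x⟫_ℝ • T (e i)) ((T - P s) x) := by
    have := (s.hasSum_compl_iff (f := fun i => ⟪e i, x⟫_ℝ • T (e i)) (a := (T - P s) x)).2
    refine this ?_
    convert hx using 1
    simp [P]
  refine le_of_tendsto hx'.norm (Eventually.of_forall fun t => ?_)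
  calc ‖∑ i ∈ t, ⟪e i, x⟫_ℝ • T (e i)‖ ≤ ∑ i ∈ t, ‖T (e i)‖ * ‖⟪e i, x⟫_ℝ‖ := by
        refine (norm_sum_le _ _).trans_eq (Finset.sum_congr rfl fun i _ => ?_)
        rw [norm_smul, mul_comm]
    _ ≤ √(∑ i ∈ t, ‖T (e i)‖ ^ 2) * √(∑ i ∈ t, ‖⟪e i, x⟫_ℝ‖ ^ 2) :=
        Real.sum_mul_le_sqrt_mul_sqrt _ _ _
    _ ≤ √(∑' i : {i // i ∉ s}, ‖T (e i)‖ ^ 2) * ‖x‖ := by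
        gcongr
        · exact (hsum.subtype _).sum_le_tsum t fun _ _ => by positivity
        · rw [Real.sqrt_le_left (norm_nonneg _)]
          exact (e.orthonormal.comp _ Subtype.val_injective).sum_inner_products_le x

variable {α : Type*} [MeasurableSpace α] {μ : Measure α}

lemma memLp_inner_of_norm_le {κ : α → H} {g : Lp ℝ 2 μ} (hκ : ∀ᵐ x ∂μ, ‖κ x‖ ≤ g x)
    (hm : ∀ f, AEStronglyMeasurable (fun x => ⟪κ x, f⟫_ℝ) μ) (f : H) :
    MemLp (fun x => ⟪κ x, f⟫_ℝ) 2 μ :=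
  ((Lp.memLp g).const_mul ‖f‖).of_le (hm f) (hκ.mono fun x hx => by
    rw [norm_mul, norm_norm, mul_comm]
    exact (norm_inner_le_norm _ _).trans (by gcongr; exact hx.trans (le_abs_self _)))

/-- The Carleman operator `f ↦ ⟪κ x, f⟫` with values in `L²`. -/
noncomputable def carlemanOperator (κ : α → H) (g : Lp ℝ 2 μ)
    (hκ : ∀ᵐ x ∂μ, ‖κ x‖ ≤ g x)
    (hm : ∀ f, AEStronglyMeasurable (fun x => ⟪κ x, f⟫_ℝ) μ) : H →L[ℝ] Lp ℝ 2 μ :=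
  LinearMap.mkContinuous
    { toFun := fun f => (memLp_inner_of_norm_le hκ hm f).toLp
      map_add' := fun f f' => by
        rw [← MemLp.toLp_add]
        congr 1
        funext x
        simp [inner_add_right]
      map_smul' := fun c f => by
        rw [RingHom.id_apply, ← MemLp.toLp_const_smul]
        congr 1
        funext x
        simp [inner_smul_right] }
    ‖g‖ fun f => by
      rw [mul_comm]
      refine Lp.norm_le_mul_norm_of_ae_le_mul ?_
      filter_upwards [hκ, (memLp_inner_of_norm_le hκ hm f).coeFn_toLp] with x hx hx'
      simp only [LinearMap.coe_mk, AddHom.coe_mk]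
      rw [hx', mul_comm]
      exact (norm_inner_le_norm _ _).trans (by gcongr; exact hx.trans (le_abs_self _))

variable {κ : α → H} {g : Lp ℝ 2 μ} {hκ : ∀ᵐ x ∂μ, ‖κ x‖ ≤ g x}
  {hm : ∀ f, AEStronglyMeasurable (fun x => ⟪κ x, f⟫_ℝ) μ}

lemma coeFn_carlemanOperator (f : H) :
    carlemanOperator κ g hκ hm f =ᵐ[μ] fun x => ⟪κ x, f⟫_ℝ :=
  (memLp_inner_of_norm_le hκ hm f).coeFn_toLp

lemma integrable_sq_Lp (f : Lp ℝ 2 μ) : Integrable (fun x => f x ^ 2) μ :=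
  (Lp.memLp f).integrable_sq

lemma norm_sq_Lp (f : Lp ℝ 2 μ) : ‖f‖ ^ 2 = ∫ x, f x ^ 2 ∂μ := by
  rw [← real_inner_self_eq_norm_sq, L2.inner_def]
  simp [pow_two]

lemma isCompactOperator_carlemanOperator [CompleteSpace H] : IsCompactOperator (carlemanOperator κ g hκ hm) := by
  refine isCompactOperator_of_sum_norm_sq_le (C := ‖g‖ ^ 2) fun ι e he s => ?_
  simp only [norm_sq_Lp]
  rw [← integral_finsetSum _ fun i _ => integrable_sq_Lp _]
  refine integral_mono_ae (integrable_finsetSum _ fun i _ => integrable_sq_Lp _)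
    (integrable_sq_Lp _) ?_
  -- Bessel's inequality for κ x at each point, to be integrated against the square-integrable bound
  -- `g`.
  filter_upwards [hκ, (ae_all_iff (ι := s)).2 fun i =>
    coeFn_carlemanOperator (κ := κ) (g := g) (hκ := hκ) (hm := hm) (e i)] with x hx hx'
  calc _ = ∑ i ∈ s, ‖⟪e i, κ x⟫_ℝ‖ ^ 2 :=
        Finset.sum_congr rfl fun i hi => by
          rw [hx' ⟨i, hi⟩, Real.norm_eq_abs, sq_abs, real_inner_comm]
    _ ≤ ‖κ x‖ ^ 2 := he.sum_inner_products_le _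
    _ ≤ _ := by gcongr

end HilbertSchmidt

/-! ### The operators with kernel Ai(x + z) between half lines -/

/-- The real Hilbert space `L²(a, ∞)`. -/
abbrev L2Ioi (a : ℝ) : Type := Lp ℝ 2 (volume.restrict (Ioi a))

lemma memLp_exp_neg (a : ℝ) : MemLp (fun x : ℝ => Real.exp (-x)) 2 (volume.restrict (Ioi a)) := by
  rw [memLp_two_iff_integrable_sq (by fun_prop)]
  refine IntegrableOn.congr_fun (integrableOn_exp_mul_Ioi (by norm_num : (-2 : ℝ) < 0) a)
    (fun x _ => ?_) measurableSet_Ioi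
  simp only [← Real.exp_nat_mul]
  congr 1
  push_cast
  ring

/-- A constant `C` with `|Ai x| ≤ C e⁻ˣ`. -/
noncomputable def airyBound : ℝ := exists_abs_airyAi_le.choose

lemma abs_airyAi_le (x : ℝ) : |airyAi x| ≤ airyBound * Real.exp (-x) :=
  exists_abs_airyAi_le.choose_spec.2 x

lemma abs_airyAi_add_le (x z : ℝ) :
    |airyAi (x + z)| ≤ airyBound * Real.exp (-x) * Real.exp (-z) := by
  rw [mul_assoc, ← Real.exp_add, ← neg_add]
  exact abs_airyAi_le _

lemma memLp_airyAi_add (b x : ℝ) :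
    MemLp (fun z => airyAi (x + z)) 2 (volume.restrict (Ioi b)) :=
  ((memLp_exp_neg b).const_mul (airyBound * Real.exp (-x))).of_le (by fun_prop)
    (ae_of_all _ fun z => by
      rw [Real.norm_eq_abs]
      exact (abs_airyAi_add_le x z).trans (le_abs_self _))

/-- The translate `Ai(x + ·)` in `L²(b, ∞)`. -/
noncomputable def airyTranslate (b x : ℝ) : L2Ioi b := (memLp_airyAi_add b x).toLp

lemma coeFn_airyTranslate (b x : ℝ) :
    airyTranslate b x =ᵐ[volume.restrict (Ioi b)] fun z => airyAi (x + z) :=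
  (memLp_airyAi_add b x).coeFn_toLp

lemma inner_airyTranslate (b x : ℝ) (f : L2Ioi b) :
    ⟪airyTranslate b x, f⟫_ℝ = ∫ z in Ioi b, airyAi (x + z) * f z := by
  rw [L2.inner_def]
  refine integral_congr_ae ?_
  filter_upwards [coeFn_airyTranslate b x] with z hz
  rw [hz]
  simp [mul_comm]

lemma stronglyMeasurable_inner_airyTranslate (b : ℝ) (f : L2Ioi b) :
    StronglyMeasurable fun x => ⟪airyTranslate b x, f⟫_ℝ := by
  simp only [inner_airyTranslate]
  refine StronglyMeasurable.integral_prod_right'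
    (f := fun p : ℝ × ℝ => airyAi (p.1 + p.2) * f p.2) ?_
  exact (Continuous.stronglyMeasurable (by fun_prop)).mul
    ((Lp.stronglyMeasurable f).comp_measurable measurable_snd)

/-- The decaying exponential in `L²(a, ∞)`. -/
noncomputable def expNegLp (a : ℝ) : L2Ioi a := (memLp_exp_neg a).toLp

lemma coeFn_expNegLp (a : ℝ) :
    expNegLp a =ᵐ[volume.restrict (Ioi a)] fun x => Real.exp (-x) :=
  (memLp_exp_neg a).coeFn_toLp

lemma norm_airyTranslate_le (b x : ℝ) :
    ‖airyTranslate b x‖ ≤ airyBound * Real.exp (-x) * ‖expNegLp b‖ := by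
  refine Lp.norm_le_mul_norm_of_ae_le_mul ?_
  filter_upwards [coeFn_airyTranslate b x, coeFn_expNegLp b] with z hz hz'
  rw [hz, hz', Real.norm_eq_abs, Real.norm_eq_abs, Real.abs_exp]
  exact abs_airyAi_add_le x z

lemma ae_norm_airyTranslate_le (a b : ℝ) :
    ∀ᵐ x ∂volume.restrict (Ioi a),
      ‖airyTranslate b x‖ ≤ ((airyBound * ‖expNegLp b‖) • expNegLp a : L2Ioi a) x := by
  filter_upwards [coeFn_expNegLp a,
    Lp.coeFn_smul (airyBound * ‖expNegLp b‖) (expNegLp a)] with x hx hx'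
  rw [hx', Pi.smul_apply, hx, smul_eq_mul]
  exact (norm_airyTranslate_le b x).trans_eq (by ring)

/-- The integral operator `L²(b, ∞) → L²(a, ∞)` with kernel `Ai(x + z)`. -/
noncomputable def airyOperator (a b : ℝ) : L2Ioi b →L[ℝ] L2Ioi a :=
  carlemanOperator (airyTranslate b) ((airyBound * ‖expNegLp b‖) • expNegLp a)
    (ae_norm_airyTranslate_le a b)
    fun f => (stronglyMeasurable_inner_airyTranslate b f).aestronglyMeasurable

lemma isCompactOperator_airyOperator (a b : ℝ) : IsCompactOperator (airyOperator a b) :=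
  isCompactOperator_carlemanOperator

lemma coeFn_airyOperator (a b : ℝ) (f : L2Ioi b) :
    airyOperator a b f =ᵐ[volume.restrict (Ioi a)] fun x => ⟪airyTranslate b x, f⟫_ℝ :=
  coeFn_carlemanOperator f

lemma integrable_exp_neg_mul (a : ℝ) (f : L2Ioi a) :
    Integrable (fun x => Real.exp (-x) * f x) (volume.restrict (Ioi a)) :=
  (memLp_exp_neg a).integrable_mul (Lp.memLp f)

lemma integrable_airyAi_mul_mul (a b : ℝ) (f : L2Ioi b) (g : L2Ioi a) :
    Integrable (fun p : ℝ × ℝ => airyAi (p.1 + p.2) * f p.2 * g p.1)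
      ((volume.restrict (Ioi a)).prod (volume.restrict (Ioi b))) := by
  refine (((integrable_exp_neg_mul a g).mul_prod (integrable_exp_neg_mul b f)).norm.const_mul
    airyBound).mono' ?_ (ae_of_all _ fun p => ?_)
  · exact (((Continuous.stronglyMeasurable (by fun_prop)).mul
      ((Lp.stronglyMeasurable f).comp_measurable measurable_snd)).mul
      ((Lp.stronglyMeasurable g).comp_measurable measurable_fst)).aestronglyMeasurable
  · simp only [norm_mul, Real.norm_eq_abs, Real.abs_exp]
    calc _ ≤ (airyBound * Real.exp (-p.1) * Real.exp (-p.2)) * |f p.2| * |g p.1| := by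
          gcongr; exact abs_airyAi_add_le _ _
      _ = _ := by ring

/-- Fubini and the symmetry of Ai(x + z): exchanging the half lines gives the adjoint. -/
lemma inner_airyOperator_left (a b : ℝ) (f : L2Ioi b) (g : L2Ioi a) :
    ⟪airyOperator a b f, g⟫_ℝ = ⟪f, airyOperator b a g⟫_ℝ := by
  rw [L2.inner_def, L2.inner_def]
  calc _ = ∫ x in Ioi a, ∫ z in Ioi b, airyAi (x + z) * f z * g x := by
        refine integral_congr_ae ?_
        filter_upwards [coeFn_airyOperator a b f] with x hx
        rw [hx, inner_airyTranslate, integral_mul_const]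
        simp [mul_comm]
    _ = ∫ z in Ioi b, ∫ x in Ioi a, airyAi (x + z) * f z * g x :=
        integral_integral_swap (integrable_airyAi_mul_mul a b f g)
    _ = _ := by
        refine integral_congr_ae ?_
        filter_upwards [coeFn_airyOperator b a g] with z hz
        rw [hz, inner_airyTranslate]
        simp only [RCLike.inner_apply, conj_trivial]
        rw [← integral_mul_const]
        refine integral_congr_ae (ae_of_all _ fun x => ?_)
        simp only
        rw [add_comm z x]
        ring

lemma airyKernel_comm (x y : ℝ) : airyKernel x y = airyKernel y x := by
  simp only [airyKernel_eq_integral, mul_comm]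

/-- The operator on `L²(s, ∞)` with the Airy kernel. -/
noncomputable def airyKernelOperator (s : ℝ) : L2Ioi s →L[ℝ] L2Ioi s :=
  (airyOperator s 0).comp (airyOperator 0 s)

lemma coeFn_airyOperator_airyTranslate (s x : ℝ) :
    airyOperator s 0 (airyTranslate 0 x) =ᵐ[volume.restrict (Ioi s)] airyKernel x := by
  filter_upwards [coeFn_airyOperator s 0 (airyTranslate 0 x)] with y hy
  rw [hy, inner_airyTranslate, airyKernel_comm, airyKernel_eq_integral]
  refine integral_congr_ae ?_
  filter_upwards [coeFn_airyTranslate 0 x] with z hz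
  rw [hz]

lemma integrableOn_airyKernel_mul (s x : ℝ) (f : L2Ioi s) :
    IntegrableOn (fun y => airyKernel x y * f y) (Ioi s) := by
  refine ((Lp.memLp (airyOperator s 0 (airyTranslate 0 x))).integrable_mul (Lp.memLp f)).congr ?_
  filter_upwards [coeFn_airyOperator_airyTranslate s x] with y hy
  rw [Pi.mul_apply, hy]

lemma coeFn_airyKernelOperator (s : ℝ) (f : L2Ioi s) :
    airyKernelOperator s f =ᵐ[volume.restrict (Ioi s)]
      fun x => ∫ y in Ioi s, airyKernel x y * f y := by
  filter_upwards [coeFn_airyOperator s 0 (airyOperator 0 s f)] with x hx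
  rw [airyKernelOperator, ContinuousLinearMap.comp_apply, hx, ← inner_airyOperator_left,
    L2.inner_def]
  refine integral_congr_ae ?_
  filter_upwards [coeFn_airyOperator_airyTranslate s x] with y hy
  rw [hy]
  simp [mul_comm]

lemma isAiryEigenfunction_iff (s ν : ℝ) (f : L2Ioi s) :
    IsAiryEigenfunction s ν f ↔ f ≠ 0 ∧ airyKernelOperator s f = ν • f := by
  refine and_congr_right fun _ => ⟨fun h => ?_, fun h => ?_⟩
  · refine Lp.ext ?_
    filter_upwards [h, coeFn_airyKernelOperator s f, Lp.coeFn_smul ν f] with x hx hx' hx''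
    rw [hx', hx'', hx.2]; rfl
  · filter_upwards [coeFn_airyKernelOperator s f, Lp.coeFn_smul ν f] with x hx' hx''
    refine ⟨integrableOn_airyKernel_mul s x f, ?_⟩
    rw [← hx', h, hx'']; rfl

lemma inner_airyKernelOperator (s : ℝ) (f g : L2Ioi s) :
    ⟪airyKernelOperator s f, g⟫_ℝ = ⟪airyOperator 0 s f, airyOperator 0 s g⟫_ℝ :=
  inner_airyOperator_left s 0 _ g

lemma isSymmetric_airyKernelOperator (s : ℝ) :
    (airyKernelOperator s : L2Ioi s →ₗ[ℝ] L2Ioi s).IsSymmetric := fun f g => by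
  simp only [ContinuousLinearMap.coe_coe]
  rw [inner_airyKernelOperator, ← real_inner_comm f, inner_airyKernelOperator, real_inner_comm]

lemma isCompactOperator_airyKernelOperator (s : ℝ) : IsCompactOperator (airyKernelOperator s) :=
  (isCompactOperator_airyOperator s 0).comp_clm _

lemma inner_airyKernelOperator_self (s : ℝ) (f : L2Ioi s) :
    ⟪airyKernelOperator s f, f⟫_ℝ = ‖airyOperator 0 s f‖ ^ 2 := by
  rw [inner_airyKernelOperator, real_inner_self_eq_norm_sq]

/-! ### Test functions, contraction and the limit of norms -/

/-- The functions in `L²(b, ∞)` that are smooth with compact support in `(b, ∞)`. -/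
def testFunctions (b : ℝ) : Submodule ℝ (L2Ioi b) where
  carrier := {f | ∃ w : ℝ → ℝ, ContDiff ℝ ∞ w ∧ HasCompactSupport w ∧ tsupport w ⊆ Ioi b ∧
    f =ᵐ[volume.restrict (Ioi b)] w}
  zero_mem' := ⟨0, contDiff_const, HasCompactSupport.zero, by simp, Lp.coeFn_zero _ _ _⟩
  add_mem' := by
    rintro f g ⟨w, h1, h2, h3, h4⟩ ⟨v, g1, g2, g3, g4⟩
    exact ⟨w + v, h1.add g1, h2.add g2, (tsupport_add w v).trans (union_subset h3 g3),
      (Lp.coeFn_add f g).trans (h4.add g4)⟩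
  smul_mem' := by
    rintro c f ⟨w, h1, h2, h3, h4⟩
    exact ⟨c • w, h1.const_smul c, h2.smul_left (f := fun _ => c),
      (tsupport_smul_subset_right (fun _ => c) w).trans h3,
      (Lp.coeFn_smul c f).trans (h4.const_smul c)⟩

/-- An element orthogonal to all test functions vanishes almost everywhere, by the fundamental lemma
of the calculus of variations. -/
lemma dense_testFunctions (b : ℝ) : (testFunctions b).topologicalClosure = ⊤ := by
  rw [Submodule.topologicalClosure_eq_top_iff, Submodule.eq_bot_iff]
  intro f hf
  have hloc : LocallyIntegrableOn f (Ioi b) :=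
    (locallyIntegrableOn_of_locallyIntegrable_restrict
      ((Lp.memLp f).locallyIntegrable one_le_two))
  have := isOpen_Ioi.ae_eq_zero_of_integral_contDiff_smul_eq_zero hloc fun w h1 h2 h3 => by
    have hw : MemLp w 2 (volume.restrict (Ioi b)) :=
      (h1.continuous.memLp_of_hasCompactSupport h2).restrict _
    have h0 := (Submodule.mem_orthogonal _ _).1 hf hw.toLp ⟨w, h1, h2, h3, hw.coeFn_toLp⟩
    rw [L2.inner_def] at h0
    rw [← setIntegral_eq_integral_of_forall_compl_eq_zero (s := Ioi b), ← h0]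
    · refine integral_congr_ae ?_
      filter_upwards [hw.coeFn_toLp] with x hx
      rw [hx]
      simp [mul_comm]
    · intro x hx
      rw [image_eq_zero_of_notMem_tsupport fun h => hx (h3 h), zero_smul]
  refine Lp.ext ?_
  filter_upwards [(ae_restrict_iff' measurableSet_Ioi).2 this, Lp.coeFn_zero ℝ 2
    (volume.restrict (Ioi b))] with x hx hx'
  rw [hx, hx', Pi.zero_apply]

lemma norm_sq_eq_of_ae_eq {b : ℝ} {f : L2Ioi b} {w : ℝ → ℝ} (hs : tsupport w ⊆ Ioi b)
    (hf : f =ᵐ[volume.restrict (Ioi b)] w) : ‖f‖ ^ 2 = ∫ x, w x ^ 2 := by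
  rw [norm_sq_Lp, ← setIntegral_eq_integral_of_forall_compl_eq_zero (f := fun x => w x ^ 2)
    (s := Ioi b)]
  · exact integral_congr_ae (hf.mono fun x hx => by simp only [hx])
  · intro x hx
    rw [image_eq_zero_of_notMem_tsupport fun h => hx (hs h), zero_pow two_ne_zero]

lemma norm_sq_airyOperator_of_ae_eq {a b : ℝ} {f : L2Ioi b} {w : ℝ → ℝ}
    (hs : tsupport w ⊆ Ioi b) (hf : f =ᵐ[volume.restrict (Ioi b)] w) :
    ‖airyOperator a b f‖ ^ 2 = ∫ x in Ioi a, airyTransform w x ^ 2 := by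
  rw [norm_sq_Lp]
  refine integral_congr_ae ?_
  filter_upwards [coeFn_airyOperator a b f] with x hx
  rw [hx, inner_airyTranslate, airyTransform, ← setIntegral_eq_integral_of_forall_compl_eq_zero
    (f := fun z => airyAi (x + z) * w z) (s := Ioi b)]
  · congr 1
    exact integral_congr_ae (hf.mono fun z hz => by simp only [hz])
  · intro z hz
    rw [image_eq_zero_of_notMem_tsupport fun h => hz (hs h), mul_zero]

/-- For a test function the left side is the Airy transform's L² norm over (a, ∞) only; density
extends the bound. -/
lemma norm_airyOperator_apply_le (a b : ℝ) (f : L2Ioi b) : ‖airyOperator a b f‖ ≤ ‖f‖ := by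
  have hclosed : IsClosed {f : L2Ioi b | ‖airyOperator a b f‖ ≤ ‖f‖} :=
    isClosed_le (by fun_prop) (by fun_prop)
  have hsub : (testFunctions b : Set (L2Ioi b)) ⊆ {f | ‖airyOperator a b f‖ ≤ ‖f‖} := by
    rintro f ⟨w, h1, h2, h3, h4⟩
    refine le_of_sq_le_sq ?_ (norm_nonneg _)
    rw [norm_sq_airyOperator_of_ae_eq h3 h4, norm_sq_eq_of_ae_eq h3 h4,
      ← integral_sq_airyTransform h1 h2]
    exact setIntegral_le_integral (memLp_airyTransform h1 h2).integrable_sq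
      (ae_of_all _ fun x => sq_nonneg _)
  have := closure_minimal hsub hclosed
  rw [← Submodule.topologicalClosure_coe, dense_testFunctions] at this
  exact this (mem_univ f)

lemma tendsto_norm_sq_airyOperator {b : ℝ} {f : L2Ioi b} (hf : f ∈ testFunctions b) :
    Tendsto (fun a => ‖airyOperator a b f‖ ^ 2) atBot (𝓝 (‖f‖ ^ 2)) := by
  obtain ⟨w, h1, h2, h3, h4⟩ := hf
  simp only [norm_sq_airyOperator_of_ae_eq h3 h4]
  rw [norm_sq_eq_of_ae_eq h3 h4, ← integral_sq_airyTransform h1 h2]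
  exact (aecover_Ioi tendsto_id).integral_tendsto_of_countably_generated
    (memLp_airyTransform h1 h2).integrable_sq

lemma exists_orthonormal_testFunctions (b : ℝ) (n : ℕ) :
    ∃ e : Fin n → L2Ioi b, Orthonormal ℝ e ∧ ∀ i, e i ∈ testFunctions b := by
  -- Centres at mutual distance at least 1 and outer radius 1/2 make the open supports disjoint;
  -- starting at b + 1 keeps the closed ones in (b, ∞).
  let w (i : Fin n) : ContDiffBump (b + 1 + i : ℝ) := ⟨1 / 4, 1 / 2, by norm_num, by norm_num⟩
  have hsupp (i : Fin n) : tsupport (w i) ⊆ Ioi b := by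
    rw [(w i).tsupport_eq]
    intro x hx
    have h := (abs_le.1 (Real.dist_eq x _ ▸ Metric.mem_closedBall.1 hx)).1
    have hi : (0 : ℝ) ≤ (i : ℕ) := Nat.cast_nonneg _
    simp only [w] at h
    simp only [mem_Ioi]
    linarith
  have hw (i : Fin n) : MemLp (w i) 2 (volume.restrict (Ioi b)) :=
    ((w i).continuous.memLp_of_hasCompactSupport (w i).hasCompactSupport).restrict _
  let u (i : Fin n) : L2Ioi b := (hw i).toLp
  have hmem (i : Fin n) : u i ∈ testFunctions b :=
    ⟨w i, (w i).contDiff, (w i).hasCompactSupport, hsupp i, (hw i).coeFn_toLp⟩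
  have hne (i : Fin n) : u i ≠ 0 := by
    have hpos : 0 < ‖u i‖ ^ 2 := by
      rw [norm_sq_eq_of_ae_eq (hsupp i) (hw i).coeFn_toLp]
      have hcs : HasCompactSupport fun x => w i x ^ 2 :=
        (w i).hasCompactSupport.comp_left (g := fun y : ℝ => y ^ 2) (by simp)
      refine Continuous.integral_pos_of_hasCompactSupport_nonneg_nonzero
        (x := b + 1 + i) (by have := (w i).continuous; fun_prop) hcs (fun x => sq_nonneg _) ?_
      rw [(w i).one_of_mem_closedBall (Metric.mem_closedBall_self (w i).rIn_pos.le)]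
      norm_num
    intro h
    simp [h] at hpos
  have horth {i j : Fin n} (hij : i ≠ j) : ⟪u i, u j⟫_ℝ = 0 := by
    rw [L2.inner_def]
    refine integral_eq_zero_of_ae ?_
    filter_upwards [(hw i).coeFn_toLp, (hw j).coeFn_toLp] with x hi hj
    rw [hi, hj]
    by_contra hx
    have hi' : x ∈ Function.support (w i) := fun h => hx (by simp [h])
    have hj' : x ∈ Function.support (w j) := fun h => hx (by simp [h])
    rw [(w i).support_eq, Metric.mem_ball, Real.dist_eq, abs_lt] at hi'
    rw [(w j).support_eq, Metric.mem_ball, Real.dist_eq, abs_lt] at hj'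
    simp only [w] at hi' hj'
    have h1 : ((i : ℕ) : ℝ) < (j : ℕ) + 1 := by linarith
    have h2 : ((j : ℕ) : ℝ) < (i : ℕ) + 1 := by linarith
    norm_cast at h1 h2
    omega
  refine ⟨fun i => ‖u i‖⁻¹ • u i, ⟨fun i => ?_, fun i j hij => ?_⟩,
    fun i => Submodule.smul_mem _ _ (hmem i)⟩
  · rw [norm_smul, norm_inv, norm_norm, inv_mul_cancel₀ (norm_ne_zero_iff.2 (hne i))]
  · change ⟪‖u i‖⁻¹ • u i, ‖u j‖⁻¹ • u j⟫_ℝ = 0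
    rw [real_inner_smul_left, real_inner_smul_right, horth hij]
    simp

/-! ### Bounds for the eigenvalues and their limit -/

/-- The defect `‖f‖² - ‖B f‖²` of a contraction is subadditive up to a constant. -/
lemma norm_sq_sub_norm_sq_sum_le {H G ι : Type*} [NormedAddCommGroup H] [InnerProductSpace ℝ H]
    [NormedAddCommGroup G] [InnerProductSpace ℝ G] {B : H →L[ℝ] G} (hB : ∀ f, ‖B f‖ ≤ ‖f‖)
    (s : Finset ι) (f : ι → H) :
    ‖∑ i ∈ s, f i‖ ^ 2 - ‖B (∑ i ∈ s, f i)‖ ^ 2 ≤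
      2 ^ s.card * ∑ i ∈ s, (‖f i‖ ^ 2 - ‖B (f i)‖ ^ 2) := by
  have hnonneg (x : H) : 0 ≤ ‖x‖ ^ 2 - ‖B x‖ ^ 2 :=
    sub_nonneg.2 (pow_le_pow_left₀ (norm_nonneg _) (hB x) 2)
  classical
  induction s using Finset.induction_on with
  | empty => simp
  | insert i s hi ih =>
    rw [Finset.sum_insert hi, Finset.sum_insert hi, Finset.card_insert_of_notMem hi,
      pow_succ' 2 s.card]
    set g := ∑ i ∈ s, f i
    -- Subtracting the two parallelogram laws and dropping the nonnegative defect of f i - g costs a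
    -- factor 2 for each summand.
    have h1 := parallelogram_law_with_norm ℝ (f i) g
    have h2 := parallelogram_law_with_norm ℝ (B (f i)) (B g)
    rw [← map_add, ← map_sub] at h2
    have h3 := hnonneg (f i - g)
    have h4 : 2 * (‖f i‖ ^ 2 - ‖B (f i)‖ ^ 2) ≤
        2 * 2 ^ s.card * (‖f i‖ ^ 2 - ‖B (f i)‖ ^ 2) := by
      have : (1 : ℝ) ≤ 2 ^ s.card := one_le_pow₀ one_le_two
      nlinarith [hnonneg (f i)]
    linarith

lemma airyEigenvalueLowerBounds_eq (s : ℝ) (n : ℕ) :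
    airyEigenvalueLowerBounds s n = {r : ℝ | ∃ f : Fin n → L2Ioi s, LinearIndependent ℝ f ∧
      ∀ k, ∃ ν, r ≤ ν ∧ f k ≠ 0 ∧ airyKernelOperator s (f k) = ν • f k} := by
  simp only [airyEigenvalueLowerBounds, isAiryEigenfunction_iff]

lemma inner_airyKernelOperator_self_le (s : ℝ) (f : L2Ioi s) :
    ⟪airyKernelOperator s f, f⟫_ℝ ≤ 1 * ‖f‖ ^ 2 := by
  rw [inner_airyKernelOperator_self, one_mul]
  exact pow_le_pow_left₀ (norm_nonneg _) (norm_airyOperator_apply_le 0 s f) 2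

/-- The eigenvalues of the Airy operator can be listed in decreasing order. -/
lemma isGreatest_airyEigenvalue (s : ℝ) (i : ℕ) :
    IsGreatest (airyEigenvalueLowerBounds s (i + 1)) (airyEigenvalue i s) := by
  obtain ⟨e, he, -⟩ := exists_orthonormal_testFunctions s (i + 1)
  rw [airyEigenvalue, airyEigenvalueLowerBounds_eq]
  exact isGreatest_sSup_eigenvalueLowerBounds (isCompactOperator_airyKernelOperator s)
    (isSymmetric_airyKernelOperator s)
    (fun f => by rw [inner_airyKernelOperator_self]; positivity)
    (inner_airyKernelOperator_self_le s) he.linearIndependent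

lemma airyEigenvalue_le_one (i : ℕ) (s : ℝ) : airyEigenvalue i s ≤ 1 := by
  have h := (isGreatest_airyEigenvalue s i).1
  rw [airyEigenvalueLowerBounds_eq] at h
  obtain ⟨f, -, h⟩ := h
  obtain ⟨ν, hν, hf, h⟩ := h 0
  refine hν.trans ?_
  have := inner_airyKernelOperator_self_le s (f 0)
  rw [h, real_inner_smul_left, real_inner_self_eq_norm_sq] at this
  exact le_of_mul_le_mul_right this (by positivity)

/-- With v = A f, Cauchy–Schwarz gives ‖v‖² = ⟪f, A* v⟫ ≤ ‖f‖ ‖A* v‖. Squaring and using r‖f‖² ≤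
‖v‖² leaves r‖v‖² ≤ ‖A* v‖². -/
lemma le_norm_sq_airyOperator_apply_airyOperator {r s : ℝ} {f : L2Ioi 0}
    (hf : r * ‖f‖ ^ 2 ≤ ‖airyOperator s 0 f‖ ^ 2) :
    r * ‖airyOperator s 0 f‖ ^ 2 ≤ ‖airyOperator 0 s (airyOperator s 0 f)‖ ^ 2 := by
  rcases eq_or_ne f 0 with rfl | hne
  · simp
  set v := airyOperator s 0 f
  have h1 : ‖v‖ ^ 2 ≤ ‖f‖ * ‖airyOperator 0 s v‖ := by
    rw [← real_inner_self_eq_norm_sq]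
    change ⟪airyOperator s 0 f, v⟫_ℝ ≤ _
    rw [inner_airyOperator_left]
    exact real_inner_le_norm _ _
  have hpos : 0 < ‖f‖ ^ 2 := by positivity
  have h2 : (‖v‖ ^ 2) ^ 2 ≤ ‖f‖ ^ 2 * ‖airyOperator 0 s v‖ ^ 2 := by
    rw [← mul_pow]
    exact pow_le_pow_left₀ (by positivity) h1 2
  refine le_of_mul_le_mul_left ?_ hpos
  nlinarith [sq_nonneg ‖v‖]

lemma eventually_le_airyEigenvalue (i : ℕ) {r : ℝ} (hr0 : 0 < r) (hr : r < 1) :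
    ∀ᶠ s in atBot, r ≤ airyEigenvalue i s := by
  obtain ⟨e, he, hmem⟩ := exists_orthonormal_testFunctions 0 (i + 1)
  -- The tolerance is chosen so that the factor 2^(i+1) lost in summing i + 1 defects leaves a total
  -- defect of at most (1 - r)‖f‖².
  have hev : ∀ᶠ s in atBot, ∀ k, 1 - (1 - r) / 2 ^ (i + 1) < ‖airyOperator s 0 (e k)‖ ^ 2 := by
    refine eventually_all.2 fun k => (tendsto_norm_sq_airyOperator (hmem k)).eventually_const_lt ?_
    rw [he.1 k, one_pow]
    have : 0 < (1 - r) / 2 ^ (i + 1) := div_pos (by linarith) (by positivity)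
    linarith
  filter_upwards [hev] with s hs
  have hle (f : L2Ioi 0) (hf : f ∈ Submodule.span ℝ (range e)) :
      r * ‖f‖ ^ 2 ≤ ‖airyOperator s 0 f‖ ^ 2 := by
    obtain ⟨c, rfl⟩ := (Submodule.mem_span_range_iff_exists_fun ℝ).1 hf
    have h1 := norm_sq_sub_norm_sq_sum_le (norm_airyOperator_apply_le s 0) Finset.univ
      fun k => c k • e k
    have h2 : ‖∑ k, c k • e k‖ ^ 2 = ∑ k, c k ^ 2 := by
      rw [← real_inner_self_eq_norm_sq, he.inner_sum]
      simp [pow_two]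
    have h3 : ∑ k, (‖c k • e k‖ ^ 2 - ‖airyOperator s 0 (c k • e k)‖ ^ 2) ≤
        (1 - r) / 2 ^ (i + 1) * ∑ k, c k ^ 2 := by
      rw [Finset.mul_sum]
      refine Finset.sum_le_sum fun k _ => ?_
      rw [map_smul, norm_smul, norm_smul, mul_pow, mul_pow, he.1 k, Real.norm_eq_abs, sq_abs]
      nlinarith [hs k, sq_nonneg (c k)]
    rw [Finset.card_univ, Fintype.card_fin] at h1
    have h4 := h1.trans (mul_le_mul_of_nonneg_left h3 (by positivity))
    rw [← mul_assoc, mul_div_cancel₀ _ (by positivity), ← h2] at h4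
    linarith
  -- The lower bound with r > 0 makes A injective on the span, so no dimension is lost.
  have hindep : LinearIndependent ℝ fun k => airyOperator s 0 (e k) := by
    refine he.linearIndependent.map (f := (airyOperator s 0 : L2Ioi 0 →ₗ[ℝ] L2Ioi s)) ?_
    rw [Submodule.disjoint_def]
    intro f hf hf0
    have h := hle f hf
    rw [LinearMap.mem_ker, ContinuousLinearMap.coe_coe] at hf0
    rw [hf0, norm_zero, zero_pow two_ne_zero] at h
    by_contra hne
    have : 0 < r * ‖f‖ ^ 2 := by positivity
    linarith
  refine (isGreatest_airyEigenvalue s i).2 ?_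
  rw [airyEigenvalueLowerBounds_eq]
  obtain ⟨f, hf, h⟩ := exists_linearIndependent_eigenvectors
    (isCompactOperator_airyKernelOperator s) (isSymmetric_airyKernelOperator s) (r := r) hindep
    fun v hv => by
      have hrange : range (fun k => airyOperator s 0 (e k)) =
          (airyOperator s 0 : L2Ioi 0 →ₗ[ℝ] L2Ioi s) '' range e := by
        rw [← range_comp]; rfl
      rw [hrange, ← Submodule.map_span] at hv
      obtain ⟨f, hf, rfl⟩ := hv
      rw [inner_airyKernelOperator_self]
      exact le_norm_sq_airyOperator_apply_airyOperator (hle f hf)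
  refine ⟨f, hf, fun k => ?_⟩
  obtain ⟨ν, hν, h⟩ := h k
  exact ⟨ν, hν, hf.ne_zero k, h⟩

theorem lemma2 :
    (∀ (s : ℝ) (i : ℕ),
      IsGreatest (airyEigenvalueLowerBounds s (i + 1)) (airyEigenvalue i s)) ∧
    ∀ i : ℕ, Tendsto (fun s : ℝ => airyEigenvalue i s) atBot (𝓝 1) := by
  refine ⟨isGreatest_airyEigenvalue, fun i => tendsto_order.2 ⟨fun a ha => ?_, fun a ha => ?_⟩⟩
  -- The midpoint of max a 0 and 1 serves as r: positive, below 1 and strictly above a.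
  · have h1 : max a 0 < (max a 0 + 1) / 2 := by
      have : max a 0 < 1 := max_lt ha one_pos
      linarith
    have h2 : (max a 0 + 1) / 2 < 1 := by
      have : max a 0 < 1 := max_lt ha one_pos
      linarith
    filter_upwards [eventually_le_airyEigenvalue i ((le_max_right a 0).trans_lt h1) h2] with s hs
    exact ((le_max_left a 0).trans_lt h1).trans_le hs
  · exact Eventually.of_forall fun s => (airyEigenvalue_le_one i s).trans_lt ha
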